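/- Let $G=(V,E)$ be a finite simple graph with $n$ nodes. For $S\subseteq V$ let $\partial S$ be the set of nodes of $V\setminus S$ that have a neighbor in $S$. For $\phi\in(0,n)$ and $\alpha\in(0,\tfrac12]$, the graph $G$ is called a $(\phi,\alpha)$-expander if $|\partial S|/|S|\ge\phi$ for every $S\subseteq V$ with $0<|S|\le\alpha n$. In the $k$-PUSH&PULL protocol, one arbitrary node initially knows a rumor; in each synchronous round every node calls $k$ of its neighbors, chosen independently and uniformly at random with replacement; every informed node sends the rumor to the nodes it calls, and every uninformed node becomes informed if one of the nodes it calls was informed at the start of the round. **Theorem.** For every $c>0$ there is a constant $C>0$, depending only on $c$, such that the following holds. Let $\phi>1$ and $\alpha>\tfrac{1}{2+2\phi}$, let $G$ be a $(\phi,\alpha)$-expander on $n$ nodes such that $\alpha n$ is an integer, and let $k$ be an integer with $k>\log^3 n$ (natural logarithm). Then for every initially informed node, with probability at least $1-n^{-c}$, all nodes are informed within $$C\left(\log_\phi n+\phi^{-1}\Big(\alpha-\tfrac{1}{2+2\phi}\Big)^{-1}\right)\max\{1,\log_k n\}$$ rounds of $k$-PUSH&PULL. (For $k\le n$ the maximum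 is $\log_k n$.) -/

import Mathlib

noncomputable section

namespace RumorSpreading

variable {V : Type*} [Fintype V] [DecidableEq V] (G : SimpleGraph V) [DecidableRel G.Adj]

/-- The (outer vertex) boundary `N(S) ∩ (V \ S)` of a set of nodes. -/
def boundary (S : Finset V) : Finset V :=
  {v | v ∉ S ∧ ∃ s ∈ S, G.Adj s v}

/-- `(φ, α)`-small-set vertex expander: `φ ∈ (0, n)`, `α ∈ (0, 1/2]`, and
`|∂S| / |S| ≥ φ` for every set `S` of nodes with `0 < |S| ≤ α n`. -/
def IsVertexExpander (φ α : ℝ) : Prop :=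
  (0 < φ ∧ φ < Fintype.card V) ∧ (0 < α ∧ α ≤ 1 / 2) ∧
    ∀ S : Finset V, 0 < S.card → (S.card : ℝ) ≤ α * Fintype.card V →
      φ ≤ ((boundary G S).card : ℝ) / S.card

/-- The nodes that `v` may call: its neighbours. An isolated node calls only itself, which has
no effect. -/
def callees (v : V) : Finset V :=
  if (G.neighborFinset v).Nonempty then G.neighborFinset v else {v}

theorem callees_nonempty (v : V) : (callees G v).Nonempty := by
  unfold callees
  split_ifs with h
  · exact h
  · exact Finset.singleton_nonempty v

/-- All outcomes of the calls of one round: `x v i` is the node reached by the `i`-th of the `k`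
calls of `v`. Repetitions are allowed (sampling with replacement). -/
def callOutcomes (k : ℕ) : Finset (V → Fin k → V) :=
  Fintype.piFinset fun v => Fintype.piFinset fun _ => callees G v

theorem callOutcomes_nonempty (k : ℕ) : (callOutcomes G k).Nonempty := by
  simp [callOutcomes, Fintype.piFinset_nonempty, callees_nonempty]

/-- The joint law of all calls of one round. The uniform law on the product set `callOutcomes`
means: all calls are independent, and each call of `v` is uniform on the neighbours of `v`. -/
def roundCalls (k : ℕ) : PMF (V → Fin k → V) :=
  PMF.uniformOfFinset (callOutcomes G k) (callOutcomes_nonempty G k)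

/-- One round: every informed node sends the rumor to the `k` nodes it calls (PUSH), and every
uninformed node requests the rumor from the `k` nodes it calls (PULL). -/
def step {k : ℕ} (I : Finset V) (x : V → Fin k → V) : Finset V :=
  I ∪ ({v | ∃ u ∈ I, ∃ i, x u i = v} : Finset V) ∪ ({v | v ∉ I ∧ ∃ i, x v i ∈ I} : Finset V)

/-- The law of the set of informed nodes after `t` rounds of `k`-PUSH&PULL, when initially only
`s` knows the rumor. The calls of different rounds are independent. -/
def informedLaw (k : ℕ) (s : V) : ℕ → PMF (Finset V)
  | 0 => PMF.pure {s}
  | t + 1 => (informedLaw k s t).bind fun I => (roundCalls G k).map (step I)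

/-- The probability that all nodes are informed after at most `t` rounds (the set of informed
nodes only grows). -/
def probAllInformed (k : ℕ) (s : V) (t : ℕ) : ℝ :=
  (informedLaw G k s t Finset.univ).toReal

end RumorSpreading

end

/-!
The proof follows the rumor in phases, each of which starts from a set `S` of informed nodes
and a set `U` of uninformed nodes with neighbors in `S`. Within `2 J` rounds with many calls per
node, where `J` is of order `log_k n`, at least `|U| / 64` new nodes are informed
(`expect_gain_le`).

*Growth.* It may be impossible to inform many nodes of `U` quickly by going forward only: all of
them may hang on a few nodes with a lot of neighbors. So a phase keeps, for every node `w`, a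
set `M w` of informed neighbors from which `w` may pull the rumor; at the start these are single
neighbors of the nodes of `U`. The nodes that pull from `M` within one round form a random
sample `X`, and the next `M w` consists of the neighbors of `w` in `X`. The number of pairs
(the *load* of `M`) grows by a factor of about `k ^ (1 / 3)` per round, because a node of degree
`d` is sampled with probability proportional to `|M w| / d` and then contributes `d` pairs. If
nodes of very large degree carry a share of the load, then the sample is not concentrated;
however, in this case a push reaches one of them, and its neighborhood is a better start. Since
the load is at most `n²`, the growth must end within `J` rounds, which happens only when nodes
with a share of the load have so many informed neighbors that all of them pull the rumor
(`expect_stalls_le`).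

*Backtracking.* What is gained far from `S` has to be brought back to `U`. If nodes with a share
of the load of the last `M` are informed, then they carry the rumor back to the previous sample
by one round, and so on; in contrapositive form, if few of the previous pairs are informed in
the end, then few of the later ones were informed one round earlier (`contamination_le`). The
set informed in the end depends on the sample, but a union bound over *all* nodes `y` controls
the number of edges from `y` to the sample, which makes the argument uniform in that set. The
errors of the levels add up to a small constant.

*Few calls.* A round with `r * k` calls is dominated by `r` rounds with `k` calls
(`expect_mul_calls_le`), so a constant number of rounds replaces each round with many calls.

*Expansion.* While at most `α n` nodes are informed, the boundary has at least `φ` times as many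
nodes, and a phase multiplies the number of informed nodes by `1 + φ / 64` (`reach_small`).
With `|S| = α n`, the set `S` and its boundary cover `(1 + φ) α n = n / 2 + x` nodes, where
`x = (1 + φ) n (α - 1 / (2 + 2 φ))`. As long as `h` nodes are missing to `n / 2`, there are
`h + x` nodes to be gained from; phases whose length is proportional to `n / (h + x)` reduce
`h + x` geometrically, and their total length is of order `n / x` (`reach_middle`).

*Reversal of time.* From more than half of the nodes the rumor reaches a given node `v` since
the process is symmetric: run backwards, the set of nodes from which `v` learns the rumor is a
rumor spreading from `v`, which also covers more than half of the nodes (`le_reach_univ`).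
-/

noncomputable section

namespace RumorSpreading

/-! ### Rounds as lists of calls, and time reversal -/

section

open scoped Classical in
/-- The indicator of a proposition, as a real number. -/
def ind (P : Prop) : ℝ := if P then 1 else 0

theorem ind_of {P : Prop} (h : P) : ind P = 1 := if_pos h

theorem ind_of_not {P : Prop} (h : ¬P) : ind P = 0 := if_neg h

theorem ind_nonneg (P : Prop) : 0 ≤ ind P := by unfold ind; split_ifs <;> norm_num

theorem ind_le_one (P : Prop) : ind P ≤ 1 := by unfold ind; split_ifs <;> norm_num

theorem ind_mono {P Q : Prop} (h : P → Q) : ind P ≤ ind Q := by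
  by_cases hP : P
  · rw [ind_of hP, ind_of (h hP)]
  · rw [ind_of_not hP]; exact ind_nonneg Q

theorem ind_le_add {P Q R : Prop} (h : P → Q ∨ R) : ind P ≤ ind Q + ind R := by
  by_cases hP : P
  · rcases h hP with h | h
    · rw [ind_of h]; linarith [ind_le_one P, ind_nonneg R]
    · rw [ind_of h]; linarith [ind_le_one P, ind_nonneg Q]
  · rw [ind_of_not hP]; linarith [ind_nonneg Q, ind_nonneg R]

theorem ind_not (P : Prop) : ind (¬P) = 1 - ind P := by
  by_cases hP : P
  · rw [ind_of hP, ind_of_not (not_not.2 hP)]; ring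
  · rw [ind_of_not hP, ind_of hP]; ring

theorem ind_exists_le_sum {ι : Type*} [Fintype ι] (P : ι → Prop) :
    ind (∃ i, P i) ≤ ∑ i, ind (P i) := by
  by_cases h : ∃ i, P i
  · obtain ⟨i, hi⟩ := h
    calc ind (∃ i, P i) ≤ 1 := ind_le_one _
      _ = ind (P i) := (ind_of hi).symm
      _ ≤ ∑ i, ind (P i) :=
        Finset.single_le_sum (f := fun i => ind (P i)) (fun i _ => ind_nonneg _)
          (Finset.mem_univ i)
  · rw [ind_of_not h]; exact Finset.sum_nonneg fun i _ => ind_nonneg _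

variable {V : Type*} [Fintype V] [DecidableEq V]

omit [Fintype V] in
theorem sum_ind_mem (s t : Finset V) : ∑ v ∈ s, ind (v ∈ t) = ((s ∩ t).card : ℝ) := by
  have h : ∀ v, ind (v ∈ t) = if v ∈ t then 1 else 0 := fun v => by
    split_ifs with hv
    · exact ind_of hv
    · exact ind_of_not hv
  simp only [h]
  rw [Finset.sum_ite_mem]
  simp

/-- All outcomes of one round in which every node `v` makes `K` calls, each to a member
of `N v`. -/
def outcomes (N : V → Finset V) (K : ℕ) : Finset (V → Fin K → V) :=
  Fintype.piFinset fun v => Fintype.piFinset fun _ => N v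

theorem outcomes_nonempty {N : V → Finset V} (hN : ∀ v, (N v).Nonempty) (K : ℕ) :
    (outcomes N K).Nonempty := by
  simp [outcomes, Fintype.piFinset_nonempty, hN]

/-- The expectation over the calls of one round. -/
def avg (N : V → Finset V) (K : ℕ) (f : (V → Fin K → V) → ℝ) : ℝ :=
  (∑ x ∈ outcomes N K, f x) / (outcomes N K).card

section Avg

variable {N : V → Finset V} {K : ℕ}

theorem avg_mono {f g : (V → Fin K → V) → ℝ} (h : ∀ x, f x ≤ g x) : avg N K f ≤ avg N K g := by
  unfold avg
  gcongr with x
  exact h x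

theorem avg_add (f g : (V → Fin K → V) → ℝ) :
    avg N K (fun x => f x + g x) = avg N K f + avg N K g := by
  unfold avg
  rw [Finset.sum_add_distrib, add_div]

theorem avg_const_mul (c : ℝ) (f : (V → Fin K → V) → ℝ) :
    avg N K (fun x => c * f x) = c * avg N K f := by
  unfold avg
  rw [← Finset.mul_sum, mul_div_assoc]

theorem avg_sum {ι : Type*} (s : Finset ι) (f : ι → (V → Fin K → V) → ℝ) :
    avg N K (fun x => ∑ i ∈ s, f i x) = ∑ i ∈ s, avg N K (f i) := by
  unfold avg
  rw [Finset.sum_comm, Finset.sum_div]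

theorem avg_const (hN : ∀ v, (N v).Nonempty) (c : ℝ) : avg N K (fun _ => c) = c := by
  have h : ((outcomes N K).card : ℝ) ≠ 0 :=
    Nat.cast_ne_zero.2 (outcomes_nonempty hN K).card_pos.ne'
  unfold avg
  rw [Finset.sum_const, nsmul_eq_mul, mul_div_cancel_left₀ _ h]

end Avg

/-- The expectation over the calls of a number of successive independent rounds. -/
def expect (N : V → Finset V) (K : ℕ) : ℕ → (List (V → Fin K → V) → ℝ) → ℝ
  | 0, F => F []
  | T + 1, F => avg N K fun x => expect N K T fun l => F (x :: l)

section Expect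

variable {N : V → Finset V} {K : ℕ}

theorem expect_mono {T : ℕ} {F F' : List (V → Fin K → V) → ℝ} (h : ∀ l, F l ≤ F' l) :
    expect N K T F ≤ expect N K T F' := by
  induction T generalizing F F' with
  | zero => exact h _
  | succ T ih => exact avg_mono fun x => ih fun l => h _

theorem expect_add (T : ℕ) (F F' : List (V → Fin K → V) → ℝ) :
    expect N K T (fun l => F l + F' l) = expect N K T F + expect N K T F' := by
  induction T generalizing F F' with
  | zero => rfl
  | succ T ih =>
    simp only [expect, ih]
    exact avg_add _ _

theorem expect_sum {ι : Type*} (s : Finset ι) (T : ℕ) (F : ι → List (V → Fin K → V) → ℝ) :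
    expect N K T (fun l => ∑ i ∈ s, F i l) = ∑ i ∈ s, expect N K T (F i) := by
  induction T generalizing F with
  | zero => rfl
  | succ T ih =>
    simp only [expect, ih]
    exact avg_sum _ _

theorem expect_const (hN : ∀ v, (N v).Nonempty) (T : ℕ) (c : ℝ) :
    expect N K T (fun _ => c) = c := by
  induction T with
  | zero => rfl
  | succ T ih => simp only [expect, ih]; exact avg_const hN c

theorem expect_append (S T : ℕ) (F : List (V → Fin K → V) → ℝ) :
    expect N K (S + T) F = expect N K S fun l => expect N K T fun l' => F (l ++ l') := by
  induction S generalizing F with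
  | zero => simp [expect]
  | succ S ih =>
    rw [Nat.succ_add]
    simp only [expect, ih, List.cons_append]

theorem expect_succ_last (T : ℕ) (F : List (V → Fin K → V) → ℝ) :
    expect N K (T + 1) F = expect N K T fun l => avg N K fun x => F (l ++ [x]) := by
  rw [expect_append]
  rfl

/-- The rounds are exchangeable; in particular their order may be reversed. -/
theorem expect_reverse (T : ℕ) (F : List (V → Fin K → V) → ℝ) :
    expect N K T (fun l => F l.reverse) = expect N K T F := by
  induction T generalizing F with
  | zero => rfl
  | succ T ih =>
    rw [expect_succ_last T F]
    simp only [expect, List.reverse_cons]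
    have h : ∀ x, expect N K T (fun l => F (l.reverse ++ [x]))
        = expect N K T (fun l => F (l ++ [x])) := fun x => ih fun l => F (l ++ [x])
    simp only [h]
    unfold avg
    rw [← expect_sum]
    have h2 : ∀ (c : ℝ) (G : List (V → Fin K → V) → ℝ),
        expect N K T (fun l => G l / c) = expect N K T G / c := by
      intro c
      clear ih F h
      induction T with
      | zero => intro G; rfl
      | succ T ih =>
        intro G
        simp only [expect, ih]
        simp only [avg, Finset.sum_div]
        exact Finset.sum_congr rfl fun _ _ => div_right_comm _ _ _
    rw [h2]

end Expect

/-- The informed set after the rounds of the list `l`, when it is `I` at the start. -/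
def spread {K : ℕ} (I : Finset V) (l : List (V → Fin K → V)) : Finset V :=
  l.foldl step I

section Spread

variable {K : ℕ}

theorem mem_step {I : Finset V} {x : V → Fin K → V} {v : V} :
    v ∈ step I x ↔ v ∈ I ∨ (∃ u ∈ I, ∃ i, x u i = v) ∨ ∃ i, x v i ∈ I := by
  simp only [step, Finset.mem_union, Finset.mem_filter, Finset.mem_univ, true_and]
  by_cases hv : v ∈ I <;> simp [hv]

theorem subset_step (I : Finset V) (x : V → Fin K → V) : I ⊆ step I x :=
  fun _ hv => mem_step.2 (Or.inl hv)

theorem step_mono {I J : Finset V} (h : I ⊆ J) (x : V → Fin K → V) : step I x ⊆ step J x := by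
  intro v hv
  rw [mem_step] at hv ⊢
  rcases hv with hv | ⟨u, hu, i, hi⟩ | ⟨i, hi⟩
  · exact Or.inl (h hv)
  · exact Or.inr (Or.inl ⟨u, h hu, i, hi⟩)
  · exact Or.inr (Or.inr ⟨i, h hi⟩)

@[simp] theorem spread_nil (I : Finset V) : spread (K := K) I [] = I := rfl

@[simp] theorem spread_cons (I : Finset V) (x : V → Fin K → V) (l : List (V → Fin K → V)) :
    spread I (x :: l) = spread (step I x) l := rfl

theorem spread_append (I : Finset V) (l l' : List (V → Fin K → V)) :
    spread I (l ++ l') = spread (spread I l) l' := List.foldl_append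

theorem subset_spread (I : Finset V) (l : List (V → Fin K → V)) : I ⊆ spread I l := by
  induction l generalizing I with
  | nil => exact subset_rfl
  | cons x l ih => exact (subset_step I x).trans (ih _)

theorem spread_mono {I J : Finset V} (h : I ⊆ J) (l : List (V → Fin K → V)) :
    spread I l ⊆ spread J l := by
  induction l generalizing I J with
  | nil => exact h
  | cons x l ih => exact ih (step_mono h x)

/-- One round transmits along the same pairs of nodes in both directions. -/
theorem step_inter_nonempty {I J : Finset V} {x : V → Fin K → V}
    (h : (step I x ∩ J).Nonempty) : (I ∩ step J x).Nonempty := by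
  obtain ⟨v, hv⟩ := h
  rw [Finset.mem_inter, mem_step] at hv
  obtain ⟨hv | ⟨u, hu, i, hi⟩ | ⟨i, hi⟩, hJ⟩ := hv
  · exact ⟨v, Finset.mem_inter.2 ⟨hv, subset_step _ _ hJ⟩⟩
  · exact ⟨u, Finset.mem_inter.2 ⟨hu, mem_step.2 (Or.inr (Or.inr ⟨i, hi ▸ hJ⟩))⟩⟩
  · exact ⟨x v i, Finset.mem_inter.2 ⟨hi, mem_step.2 (Or.inr (Or.inl ⟨v, hJ, i, rfl⟩))⟩⟩

/-- Time reversal: a rumor that starts in `I` and one that starts in `J` and runs through the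
rounds in reverse order meet in the same cases. -/
theorem spread_inter_nonempty {I J : Finset V} (l : List (V → Fin K → V))
    (h : (I ∩ spread J l.reverse).Nonempty) : (spread I l ∩ J).Nonempty := by
  induction l generalizing I J with
  | nil => simpa using h
  | cons x l ih =>
    rw [List.reverse_cons, spread_append] at h
    rw [spread_cons]
    refine ih ?_
    rw [Finset.inter_comm] at h ⊢
    exact step_inter_nonempty h

end Spread

end

/-! ### Independent calls and Chernoff bounds -/

section

variable {V : Type*} [Fintype V] [DecidableEq V]

section Independence

variable {N : V → Finset V} {K : ℕ}

/-- One of the first `κ` calls of `w` reaches a member of `M w`. -/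
def Hits {K : ℕ} (κ : ℕ) (M : V → Finset V) (x : V → Fin K → V) (w : V) : Prop :=
  ∃ i : Fin K, i.val < κ ∧ x w i ∈ M w

/-- The probability that one of `κ` calls of `w` reaches a member of `M w`. -/
def hitProb (N : V → Finset V) (κ : ℕ) (M : V → Finset V) (w : V) : ℝ :=
  1 - (1 - ((M w).card : ℝ) / (N w).card) ^ κ

omit [Fintype V] in
theorem sum_ind_calls {T W : Finset V} (hT : T ⊆ W) (hW : W.Nonempty) {κ : ℕ} (hκ : κ ≤ K) :
    ∑ z ∈ Fintype.piFinset (fun _ : Fin K => W), ind (∃ i : Fin K, i.val < κ ∧ z i ∈ T)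
      = (W.card : ℝ) ^ K * (1 - (1 - (T.card : ℝ) / W.card) ^ κ) := by
  have hW0 : (W.card : ℝ) ≠ 0 := Nat.cast_ne_zero.2 hW.card_pos.ne'
  have h1 : ∀ z : Fin K → V, ind (∃ i : Fin K, i.val < κ ∧ z i ∈ T)
      = 1 - ∏ i : Fin K, (if i.val < κ then ind (z i ∉ T) else 1) := by
    intro z
    by_cases h : ∃ i : Fin K, i.val < κ ∧ z i ∈ T
    · obtain ⟨i, hi, hz⟩ := h
      rw [ind_of ⟨i, hi, hz⟩, Finset.prod_eq_zero (Finset.mem_univ i), sub_zero]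
      rw [if_pos hi, ind_of_not (not_not.2 hz)]
    · rw [ind_of_not h, Finset.prod_eq_one, sub_self]
      intro i _
      split_ifs with hi
      · exact ind_of fun hz => h ⟨i, hi, hz⟩
      · rfl
  simp only [h1]
  rw [Finset.sum_sub_distrib, ← Finset.prod_univ_sum (fun _ : Fin K => W)
    (fun (i : Fin K) (v : V) => if i.val < κ then ind (v ∉ T) else 1)]
  have h2 : ∀ i : Fin K, ∑ v ∈ W, (if i.val < κ then ind (v ∉ T) else (1 : ℝ))
      = if i.val < κ then (W.card : ℝ) - T.card else W.card := by
    intro i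
    split_ifs
    · have h3 : ∀ v, ind (v ∉ T) = 1 - ind (v ∈ T) := fun v => ind_not _
      simp only [h3, Finset.sum_sub_distrib]
      have h4 : ∑ v ∈ W, ind (v ∈ T) = T.card := by
        rw [sum_ind_mem, Finset.inter_eq_right.2 hT]
      rw [h4]; simp
    · simp
  simp only [h2]
  rw [Finset.prod_ite, Finset.prod_const, Finset.prod_const]
  have h5 : (Finset.univ.filter fun i : Fin K => i.val < κ).card = κ := by
    rw [Fin.card_filter_val_lt, min_eq_right hκ]
  have h6 : (Finset.univ.filter fun i : Fin K => ¬ i.val < κ).card = K - κ := by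
    have := Finset.card_filter_add_card_filter_not (s := (Finset.univ : Finset (Fin K)))
      (fun i : Fin K => i.val < κ)
    rw [h5, Finset.card_univ, Fintype.card_fin] at this
    omega
  rw [h5, h6]
  have h7 : (1 - (T.card : ℝ) / W.card) ^ κ * (W.card : ℝ) ^ κ = ((W.card : ℝ) - T.card) ^ κ := by
    rw [← mul_pow]; congr 1; field_simp
  have h8 : (W.card : ℝ) ^ K = (W.card : ℝ) ^ κ * (W.card : ℝ) ^ (K - κ) := by
    rw [← pow_add]; congr 1; omega
  rw [Finset.sum_const, Fintype.card_piFinset]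
  simp only [Finset.prod_const, Finset.card_univ, Fintype.card_fin, nsmul_eq_mul, mul_one,
    Nat.cast_pow]
  rw [← h7, h8]
  ring

/-- The calls of different nodes are independent. -/
theorem avg_prod_hits (hN : ∀ v, (N v).Nonempty) {κ : ℕ} (hκ : κ ≤ K) {M : V → Finset V}
    (hM : ∀ w, M w ⊆ N w) (a : V → ℝ) :
    avg N K (fun x => ∏ w, (1 + a w * ind (Hits κ M x w)))
      = ∏ w, (1 + a w * hitProb N κ M w) := by
  unfold avg outcomes Hits
  beta_reduce
  rw [← Finset.prod_univ_sum (fun w => Fintype.piFinset fun _ : Fin K => N w)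
    (fun (w : V) (z : Fin K → V) => 1 + a w * ind (∃ i : Fin K, i.val < κ ∧ z i ∈ M w)),
    Fintype.card_piFinset]
  push_cast
  rw [← Finset.prod_div_distrib]
  refine Finset.prod_congr rfl fun w _ => ?_
  have hW0 : ((N w).card : ℝ) ≠ 0 := Nat.cast_ne_zero.2 (hN w).card_pos.ne'
  rw [Finset.sum_add_distrib, ← Finset.mul_sum, sum_ind_calls (hM w) (hN w) hκ,
    Finset.sum_const, Fintype.card_piFinset]
  simp only [Finset.prod_const, Finset.card_univ, Fintype.card_fin, nsmul_eq_mul, mul_one,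
    Nat.cast_pow, hitProb]
  field_simp

omit [Fintype V] [DecidableEq V] in
theorem card_div_le_one (hN : ∀ v, (N v).Nonempty) {M : V → Finset V} (hM : ∀ w, M w ⊆ N w)
    (w : V) : ((M w).card : ℝ) / (N w).card ≤ 1 := by
  have hW0 : (0 : ℝ) < (N w).card := Nat.cast_pos.2 (hN w).card_pos
  rw [div_le_one hW0]
  exact_mod_cast Finset.card_le_card (hM w)

omit [Fintype V] [DecidableEq V] in
theorem hitProb_nonneg (hN : ∀ v, (N v).Nonempty) {M : V → Finset V} (hM : ∀ w, M w ⊆ N w)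
    (κ : ℕ) (w : V) : 0 ≤ hitProb N κ M w := by
  have h := card_div_le_one hN hM w
  have h0 : 0 ≤ ((M w).card : ℝ) / (N w).card := by positivity
  unfold hitProb
  linarith [pow_le_one₀ (n := κ) (by linarith : 0 ≤ 1 - ((M w).card : ℝ) / (N w).card)
    (by linarith)]

omit [Fintype V] [DecidableEq V] in
theorem hitProb_le_one (hN : ∀ v, (N v).Nonempty) {M : V → Finset V} (hM : ∀ w, M w ⊆ N w)
    (κ : ℕ) (w : V) : hitProb N κ M w ≤ 1 := by
  have h := card_div_le_one hN hM w
  unfold hitProb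
  linarith [pow_nonneg (by linarith : 0 ≤ 1 - ((M w).card : ℝ) / (N w).card) κ]

omit [Fintype V] [DecidableEq V] in
theorem hitProb_le (hN : ∀ v, (N v).Nonempty) {M : V → Finset V} (hM : ∀ w, M w ⊆ N w)
    (κ : ℕ) (w : V) : hitProb N κ M w ≤ κ * (((M w).card : ℝ) / (N w).card) := by
  have h := card_div_le_one hN hM w
  have := one_add_mul_le_pow (a := -(((M w).card : ℝ) / (N w).card)) (by linarith) κ
  unfold hitProb
  rw [← sub_eq_add_neg] at this
  linarith

omit [Fintype V] [DecidableEq V] in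
/-- Second order lower bound: if few hits are expected then hardly any are lost to
repetitions. -/
theorem le_hitProb (hN : ∀ v, (N v).Nonempty) {M : V → Finset V} (hM : ∀ w, M w ⊆ N w)
    {κ : ℕ} {w : V} {ε : ℝ} (hε : κ * (((M w).card : ℝ) / (N w).card) ≤ ε) :
    (1 - ε) * (κ * (((M w).card : ℝ) / (N w).card)) ≤ hitProb N κ M w := by
  have h := card_div_le_one hN hM w
  have h0 : 0 ≤ ((M w).card : ℝ) / (N w).card := by positivity
  set y := ((M w).card : ℝ) / (N w).card with hy
  have h1 : (1 - y) ^ κ ≤ Real.exp (-(κ * y)) := by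
    calc (1 - y) ^ κ ≤ (Real.exp (-y)) ^ κ := by
          refine pow_le_pow_left₀ (by linarith) ?_ κ
          linarith [Real.add_one_le_exp (-y)]
      _ = Real.exp (-(κ * y)) := by rw [← Real.exp_nat_mul]; ring_nf
  have h2 : Real.exp (-(κ * y)) ≤ 1 / (1 + κ * y) := by
    rw [Real.exp_neg, ← one_div]
    have h3 : 0 ≤ κ * y := by positivity
    apply one_div_le_one_div_of_le (by linarith)
    linarith [Real.add_one_le_exp (κ * y)]
  have h3 : 0 ≤ κ * y := by positivity
  have h4 : 1 / (1 + κ * y) ≤ 1 - (1 - ε) * (κ * y) := by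
    rw [div_le_iff₀ (by linarith)]
    nlinarith [mul_nonneg h3 h3, mul_nonneg h3 (sub_nonneg.2 hε),
      mul_nonneg (mul_nonneg h3 h3) (h3.trans hε)]
  unfold hitProb
  linarith

/-- The probability that none of the nodes of `W` hits. -/
theorem avg_ind_forall_not_hits (hN : ∀ v, (N v).Nonempty) {M : V → Finset V}
    (hM : ∀ w, M w ⊆ N w) (W : Finset V) :
    avg N K (fun x => ind (∀ w ∈ W, ¬Hits K M x w))
      ≤ Real.exp (-(K * ∑ w ∈ W, ((M w).card : ℝ) / (N w).card)) := by
  have h1 : ∀ x : V → Fin K → V, ind (∀ w ∈ W, ¬Hits K M x w)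
      ≤ ∏ w, (1 + (if w ∈ W then (-1 : ℝ) else 0) * ind (Hits K M x w)) := by
    intro x
    by_cases h : ∀ w ∈ W, ¬Hits K M x w
    · rw [ind_of h, Finset.prod_eq_one]
      intro w _
      split_ifs with hw
      · rw [ind_of_not (h w hw)]; simp
      · simp
    · rw [ind_of_not h]
      refine Finset.prod_nonneg fun w _ => ?_
      split_ifs
      · linarith [ind_le_one (Hits K M x w)]
      · simp
  refine (avg_mono h1).trans ?_
  rw [avg_prod_hits hN le_rfl hM, Finset.mul_sum, ← Finset.sum_neg_distrib, Real.exp_sum,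
    ← Finset.prod_subset (Finset.subset_univ W) fun w _ hw => by simp [hw]]
  refine Finset.prod_le_prod (fun w _ => ?_) fun w hw => ?_
  · split_ifs
    · linarith [hitProb_le_one hN hM K w]
  · have h := card_div_le_one hN hM w
    rw [if_pos hw, hitProb, ← mul_neg, Real.exp_nat_mul]
    have h2 : 1 + -1 * (1 - (1 - ((M w).card : ℝ) / (N w).card) ^ K)
        = (1 - ((M w).card : ℝ) / (N w).card) ^ K := by ring
    rw [h2]
    refine pow_le_pow_left₀ (by linarith) ?_ K
    exact Real.one_sub_le_exp_neg _

/-- Exponential moments of a weighted number of hits. -/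
theorem avg_exp_sum_hits (hN : ∀ v, (N v).Nonempty) {κ : ℕ} (hκ : κ ≤ K) {M : V → Finset V}
    (hM : ∀ w, M w ⊆ N w) (W : Finset V) (c : V → ℝ) :
    avg N K (fun x => Real.exp (∑ w ∈ W, c w * ind (Hits κ M x w)))
      ≤ Real.exp (∑ w ∈ W, (Real.exp (c w) - 1) * hitProb N κ M w) := by
  have h1 : ∀ x : V → Fin K → V, Real.exp (∑ w ∈ W, c w * ind (Hits κ M x w))
      = ∏ w, (1 + (if w ∈ W then Real.exp (c w) - 1 else 0) * ind (Hits κ M x w)) := by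
    intro x
    rw [Real.exp_sum, ← Finset.prod_subset (Finset.subset_univ W) fun w _ hw => by simp [hw]]
    refine Finset.prod_congr rfl fun w hw => ?_
    rw [if_pos hw]
    by_cases h : Hits κ M x w
    · rw [ind_of h]; simp
    · rw [ind_of_not h]; simp
  simp only [h1]
  rw [avg_prod_hits hN hκ hM, Real.exp_sum,
    ← Finset.prod_subset (Finset.subset_univ W) fun w _ hw => by simp [hw]]
  refine Finset.prod_le_prod (fun w hw => ?_) fun w hw => ?_
  · rw [if_pos hw]
    nlinarith [hitProb_le_one hN hM κ w, hitProb_nonneg hN hM κ w, Real.exp_pos (c w)]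
  · rw [if_pos hw]
    linarith [Real.add_one_le_exp ((Real.exp (c w) - 1) * hitProb N κ M w)]

/-- Chernoff bound, lower tail, for weights in `[0, B]`. -/
theorem avg_ind_sum_hits_lt (hN : ∀ v, (N v).Nonempty) {κ : ℕ} (hκ : κ ≤ K)
    {M : V → Finset V} (hM : ∀ w, M w ⊆ N w) (W : Finset V) (c : V → ℝ) {B ε : ℝ}
    (hc : ∀ w ∈ W, 0 ≤ c w) (hB : 0 < B) (hcB : ∀ w ∈ W, c w ≤ B) (hε : 0 < ε) :
    avg N K (fun x => ind (∑ w ∈ W, c w * ind (Hits κ M x w)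
        < (1 - ε) * ∑ w ∈ W, c w * hitProb N κ M w))
      ≤ Real.exp (-(ε ^ 2 * (∑ w ∈ W, c w * hitProb N κ M w) / (2 * B))) := by
  set μ := ∑ w ∈ W, c w * hitProb N κ M w with hμ
  have hlam : 0 < ε / B := div_pos hε hB
  have h1 : ∀ x : V → Fin K → V, ind (∑ w ∈ W, c w * ind (Hits κ M x w) < (1 - ε) * μ)
      ≤ Real.exp (ε / B * ((1 - ε) * μ))
        * Real.exp (∑ w ∈ W, (-(ε / B) * c w) * ind (Hits κ M x w)) := by
    intro x
    rw [← Real.exp_add]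
    by_cases h : ∑ w ∈ W, c w * ind (Hits κ M x w) < (1 - ε) * μ
    · rw [ind_of h]
      apply Real.one_le_exp
      have h2 : ∑ w ∈ W, (-(ε / B) * c w) * ind (Hits κ M x w)
          = -(ε / B * ∑ w ∈ W, c w * ind (Hits κ M x w)) := by
        rw [Finset.mul_sum, ← Finset.sum_neg_distrib]
        exact Finset.sum_congr rfl fun w _ => by ring
      rw [h2]
      have := mul_lt_mul_of_pos_left h hlam
      linarith
    · rw [ind_of_not h]; exact (Real.exp_pos _).le
  refine (avg_mono h1).trans ?_
  rw [avg_const_mul]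
  refine (mul_le_mul_of_nonneg_left (avg_exp_sum_hits hN hκ hM W _)
    (Real.exp_pos _).le).trans ?_
  rw [← Real.exp_add]
  apply Real.exp_le_exp.2
  have h3 : ∀ w ∈ W, (Real.exp (-(ε / B) * c w) - 1) * hitProb N κ M w
      ≤ (-(ε / B) + (ε / B) ^ 2 * B / 2) * (c w * hitProb N κ M w) := by
    intro w hw
    have hp := hitProb_nonneg hN hM κ w
    have hc0 := hc w hw
    have ht : 0 ≤ ε / B * c w := by positivity
    have h4 : Real.exp (-(ε / B * c w)) ≤ 1 - ε / B * c w + (ε / B * c w) ^ 2 / 2 := by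
      have h5 := Real.quadratic_le_exp_of_nonneg ht
      rw [Real.exp_neg, inv_le_comm₀ (Real.exp_pos _) (by nlinarith)]
      refine le_trans ?_ h5
      rw [inv_le_iff_one_le_mul₀ (by nlinarith)]
      nlinarith [mul_nonneg ht ht, mul_nonneg (mul_nonneg ht ht) (mul_nonneg ht ht)]
    have h6 : Real.exp (-(ε / B) * c w) - 1
        ≤ (-(ε / B) + (ε / B) ^ 2 * B / 2) * c w := by
      have h7 : (ε / B * c w) ^ 2 ≤ (ε / B) ^ 2 * B * c w := by
        have := mul_le_mul_of_nonneg_left (hcB w hw) (mul_nonneg (sq_nonneg (ε / B)) hc0)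
        nlinarith
      rw [neg_mul]
      linarith
    calc _ ≤ ((-(ε / B) + (ε / B) ^ 2 * B / 2) * c w) * hitProb N κ M w :=
          mul_le_mul_of_nonneg_right h6 hp
      _ = _ := by ring
  have h8 := Finset.sum_le_sum h3
  rw [← Finset.mul_sum, ← hμ] at h8
  have h9 : ε / B * ((1 - ε) * μ) + (-(ε / B) + (ε / B) ^ 2 * B / 2) * μ
      = -(ε ^ 2 * μ / (2 * B)) := by
    field_simp
    ring
  linarith

/-- Chernoff bound, upper tail, with a small relative and an additive error. -/
theorem avg_ind_lt_card_hits (hN : ∀ v, (N v).Nonempty) {κ : ℕ} (hκ : κ ≤ K)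
    {M : V → Finset V} (hM : ∀ w, M w ⊆ N w) (W : Finset V) {ε A : ℝ}
    (hε : 0 < ε) (hε1 : ε ≤ 1) :
    avg N K (fun x => ind ((1 + ε) * ∑ w ∈ W, hitProb N κ M w + A / ε
        < ∑ w ∈ W, ind (Hits κ M x w))) ≤ Real.exp (-A) := by
  set μ := ∑ w ∈ W, hitProb N κ M w with hμ
  have h1 : ∀ x : V → Fin K → V, ind ((1 + ε) * μ + A / ε < ∑ w ∈ W, ind (Hits κ M x w))
      ≤ Real.exp (-(ε * (1 + ε) * μ + A))
        * Real.exp (∑ w ∈ W, ε * ind (Hits κ M x w)) := by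
    intro x
    rw [← Real.exp_add]
    by_cases h : (1 + ε) * μ + A / ε < ∑ w ∈ W, ind (Hits κ M x w)
    · rw [ind_of h]
      apply Real.one_le_exp
      rw [← Finset.mul_sum]
      have := mul_lt_mul_of_pos_left h hε
      have h2 : ε * ((1 + ε) * μ + A / ε) = ε * (1 + ε) * μ + A := by field_simp
      linarith
    · rw [ind_of_not h]; exact (Real.exp_pos _).le
  refine (avg_mono h1).trans ?_
  rw [avg_const_mul]
  refine (mul_le_mul_of_nonneg_left (avg_exp_sum_hits hN hκ hM W _)
    (Real.exp_pos _).le).trans ?_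
  rw [← Real.exp_add, ← Finset.mul_sum]
  apply Real.exp_le_exp.2
  have hμ0 : 0 ≤ μ := Finset.sum_nonneg fun w _ => hitProb_nonneg hN hM κ w
  have h3 : Real.exp ε - 1 ≤ ε * (1 + ε) := by
    have := Real.abs_exp_sub_one_sub_id_le (x := ε) (by rw [abs_of_pos hε]; exact hε1)
    have := (abs_le.1 this).2
    nlinarith
  nlinarith [mul_le_mul_of_nonneg_right h3 hμ0]

end Independence

end

/-! ### Passing the failure of a phase back by one round -/

section

variable {V : Type*} [Fintype V] [DecidableEq V]

section Contamination

variable {N : V → Finset V} {K : ℕ}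

/-- The number of pairs `(w, x)` with `w ∈ Z` and `x ∈ M w`. -/
def load (M : V → Finset V) (Z : Finset V) : ℝ := ∑ w ∈ Z, ((M w).card : ℝ)

omit [Fintype V] [DecidableEq V] in
theorem load_nonneg (M : V → Finset V) (Z : Finset V) : 0 ≤ load M Z :=
  Finset.sum_nonneg fun _ _ => Nat.cast_nonneg _

omit [Fintype V] [DecidableEq V] in
theorem load_mono (M : V → Finset V) {Y Z : Finset V} (h : Y ⊆ Z) : load M Y ≤ load M Z :=
  Finset.sum_le_sum_of_subset_of_nonneg h fun _ _ _ => Nat.cast_nonneg _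

omit [Fintype V] in
theorem load_sdiff (M : V → Finset V) {Y Z : Finset V} (h : Y ⊆ Z) :
    load M (Z \ Y) = load M Z - load M Y := by
  unfold load
  rw [← Finset.sum_sdiff h]
  ring

omit [Fintype V] in
/-- Double counting of the edges between `F` and `Y`. -/
theorem sum_sum_neighbors (hs : ∀ u v, u ∈ N v → v ∈ N u) (F Y : Finset V) (p : V → ℝ) :
    ∑ y ∈ Y, ∑ w ∈ F ∩ N y, p w = ∑ w ∈ F, p w * ((N w ∩ Y).card : ℝ) := by
  have h : ∀ w, p w * ((N w ∩ Y).card : ℝ) = ∑ y ∈ N w ∩ Y, p w := by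
    intro w; rw [Finset.sum_const, nsmul_eq_mul, mul_comm]
  simp only [h]
  refine Finset.sum_comm' fun y w => ?_
  simp only [Finset.mem_inter]
  constructor
  · rintro ⟨hy, hw, hwy⟩; exact ⟨⟨hs _ _ hwy, hy⟩, hw⟩
  · rintro ⟨⟨hwy, hy⟩, hw⟩; exact ⟨hy, hw, hs _ _ hwy⟩

omit [Fintype V] in
theorem sum_card_neighbors (hs : ∀ u v, u ∈ N v → v ∈ N u) (X Y : Finset V) :
    ∑ y ∈ Y, ((N y ∩ X).card : ℝ) = ∑ w ∈ X, ((N w ∩ Y).card : ℝ) := by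
  have := sum_sum_neighbors hs X Y fun _ => 1
  simpa [Finset.inter_comm] using this

omit [Fintype V] in
/-- When the nodes `w` of `F` are sampled by `κ` calls to `M w`, the expected number of edges at
the sample is almost `κ` times the load of `F`. -/
theorem load_le_sum_hitProb (hN : ∀ v, (N v).Nonempty) {M : V → Finset V} (hM : ∀ w, M w ⊆ N w)
    {S F : Finset V} {κ : ℕ} {A ε : ℝ} (hA : 0 < A) (hε : 0 < ε) (hκ : κ * A ≤ ε * K)
    (hFS : ∀ w ∈ F, (K : ℝ) * (N w ∩ S).card < A * (N w).card) (hMS : ∀ w, M w ⊆ S) :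
    (1 - ε) * (κ * load M F) ≤ ∑ w ∈ F, ((N w).card : ℝ) * hitProb N κ M w := by
  have hD : ∀ w, (0 : ℝ) < (N w).card := fun w => Nat.cast_pos.2 (hN w).card_pos
  rw [load, Finset.mul_sum, Finset.mul_sum]
  refine Finset.sum_le_sum fun w hw => ?_
  have h1 : κ * (((M w).card : ℝ) / (N w).card) ≤ ε := by
    rw [← mul_div_assoc, div_le_iff₀ (hD w)]
    have h2 : ((M w).card : ℝ) ≤ (N w ∩ S).card := by
      exact_mod_cast Finset.card_le_card (Finset.subset_inter (hM w) (hMS w))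
    have h3 : (κ : ℝ) * ((M w).card : ℝ) * A ≤ ε * (N w).card * A := by
      calc (κ : ℝ) * ((M w).card : ℝ) * A = κ * A * (M w).card := by ring
        _ ≤ ε * K * (N w ∩ S).card := by gcongr
        _ = ε * (K * (N w ∩ S).card) := by ring
        _ ≤ ε * (A * (N w).card) := mul_le_mul_of_nonneg_left (hFS w hw).le hε.le
        _ = _ := by ring
    exact le_of_mul_le_mul_right h3 hA
  have h4 := mul_le_mul_of_nonneg_left (le_hitProb hN hM h1) (hD w).le
  refine le_trans (le_of_eq ?_) h4
  field_simp [(hD w).ne']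

/-- The main estimate of the backtracking argument. A sample `X` is drawn from the set `F` of
nodes by calls to the sets `M w`. If only a fraction `s` of the total load of `M` lies in the
final set `Z`, then only a fraction `s + 8 ε` of the edges at `X` leads to the set `Z'` one
round earlier, since every node outside `Z` sends few edges into `Z'`. The set `Z'` depends on
the sample; this is harmless, as the number of edges from `X` to *every* node is controlled, up
to an additive error that is paid only by the few nodes of `Z' \ S`. -/
theorem contamination_le (hN : ∀ v, (N v).Nonempty) (hs : ∀ u v, u ∈ N v → v ∈ N u)
    {M : V → Finset V} (hM : ∀ w, M w ⊆ N w) {S Z Z' F H X : Finset V} {κ : ℕ}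
    {A ε s m : ℝ} (hA : 0 < A) (hε : 0 < ε) (hε1 : ε ≤ 1 / 1000) (hs0 : 0 ≤ s) (hs1 : s ≤ 1 / 8)
    (hK : 0 < K) (hκ : κ * A ≤ ε * K) (hAK : A ≤ ε * K) (hFH : Disjoint F H)
    (hFS : ∀ w ∈ F, (K : ℝ) * (N w ∩ S).card < A * (N w).card)
    (hMS : ∀ w, M w ⊆ S) (hXF : X ⊆ F)
    (hvol : (1 - ε) * ∑ w ∈ F, ((N w).card : ℝ) * hitProb N κ M w
      ≤ ∑ w ∈ X, ((N w).card : ℝ))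
    (hup : ∀ y, ((N y ∩ X).card : ℝ) ≤ (1 + ε) * ∑ w ∈ F ∩ N y, hitProb N κ M w + A / ε)
    (hF : (1 - ε) * load M Finset.univ - load M H ≤ load M F)
    (hHZ : H ⊆ Z) (hZ : ∀ w, w ∉ Z → (K : ℝ) * (N w ∩ Z').card < A * (N w).card)
    (hload : load M Z ≤ s * load M Finset.univ)
    (hm : ((Z' \ S).card : ℝ) ≤ m) (hmε : m * (A / ε) ≤ ε * ∑ w ∈ X, ((N w).card : ℝ)) :
    ∑ y ∈ Z', ((N y ∩ X).card : ℝ) ≤ (s + 8 * ε) * ∑ w ∈ X, ((N w).card : ℝ) := by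
  set p := hitProb N κ M with hp
  set μ := ∑ w ∈ F, ((N w).card : ℝ) * p w with hμ
  set vol := ∑ w ∈ X, ((N w).card : ℝ) with hvoldef
  have hK0 : (0 : ℝ) < K := Nat.cast_pos.2 hK
  have hD : ∀ w, (0 : ℝ) < (N w).card := fun w => Nat.cast_pos.2 (hN w).card_pos
  have hp0 : ∀ w, 0 ≤ p w := hitProb_nonneg hN hM κ
  have hμ0 : 0 ≤ μ := Finset.sum_nonneg fun w _ => mul_nonneg (hD w).le (hp0 w)
  have hvol0 : 0 ≤ vol := Finset.sum_nonneg fun w _ => (hD w).le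
  have hq : ∀ w, (K : ℝ) * (N w ∩ S).card < A * (N w).card →
      ((N w ∩ S).card : ℝ) ≤ ε * (N w).card := by
    intro w h
    have : (K : ℝ) * (N w ∩ S).card ≤ K * (ε * (N w).card) := by
      nlinarith [mul_le_mul_of_nonneg_right hAK (hD w).le]
    exact le_of_mul_le_mul_left this hK0
  have hq' : ∀ w, w ∉ Z → ((N w ∩ Z').card : ℝ) ≤ ε * (N w).card := by
    intro w hw
    have : (K : ℝ) * (N w ∩ Z').card ≤ K * (ε * (N w).card) := by
      nlinarith [mul_le_mul_of_nonneg_right hAK (hD w).le, hZ w hw]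
    exact le_of_mul_le_mul_left this hK0
  -- edges from the sample to the nodes informed before the sample was drawn
  have h1 : ∑ y ∈ Z' ∩ S, ((N y ∩ X).card : ℝ) ≤ ε * vol := by
    calc ∑ y ∈ Z' ∩ S, ((N y ∩ X).card : ℝ) ≤ ∑ y ∈ S, ((N y ∩ X).card : ℝ) :=
          Finset.sum_le_sum_of_subset_of_nonneg Finset.inter_subset_right
            fun _ _ _ => Nat.cast_nonneg _
      _ = ∑ w ∈ X, ((N w ∩ S).card : ℝ) := sum_card_neighbors hs X S
      _ ≤ ∑ w ∈ X, ε * ((N w).card : ℝ) := Finset.sum_le_sum fun w hw => hq w (hFS w (hXF hw))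
      _ = ε * vol := by rw [← Finset.mul_sum]
  -- the expected number of edges from the sample to `Z'`
  have h2 : ∑ y ∈ Z', ∑ w ∈ F ∩ N y, p w ≤ ε * μ + κ * load M (F ∩ Z) := by
    rw [sum_sum_neighbors hs]
    have h3 : ∀ w ∈ F, p w * ((N w ∩ Z').card : ℝ)
        ≤ ε * ((N w).card * p w) + if w ∈ Z then κ * ((M w).card : ℝ) else 0 := by
      intro w _
      have hpw := hp0 w
      split_ifs with hw
      · have h4 : p w * ((N w ∩ Z').card : ℝ) ≤ κ * ((M w).card : ℝ) := by
          calc p w * ((N w ∩ Z').card : ℝ) ≤ p w * ((N w).card : ℝ) := by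
                gcongr; exact Finset.inter_subset_left
            _ ≤ κ * (((M w).card : ℝ) / (N w).card) * (N w).card :=
                mul_le_mul_of_nonneg_right (hitProb_le hN hM κ w) (hD w).le
            _ = κ * ((M w).card : ℝ) := by field_simp [(hD w).ne']
        have : 0 ≤ ε * ((N w).card * p w) := by positivity
        linarith
      · have := mul_le_mul_of_nonneg_left (hq' w hw) hpw
        linarith
    refine (Finset.sum_le_sum h3).trans_eq ?_
    rw [Finset.sum_add_distrib, Finset.sum_ite_mem, ← Finset.mul_sum, ← Finset.mul_sum, load]
  have h5 : ∑ y ∈ Z' \ S, ((N y ∩ X).card : ℝ)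
      ≤ (1 + ε) * (ε * μ + κ * load M (F ∩ Z)) + ε * vol := by
    calc ∑ y ∈ Z' \ S, ((N y ∩ X).card : ℝ)
        ≤ ∑ y ∈ Z' \ S, ((1 + ε) * ∑ w ∈ F ∩ N y, p w + A / ε) :=
          Finset.sum_le_sum fun y _ => hup y
      _ = (1 + ε) * ∑ y ∈ Z' \ S, ∑ w ∈ F ∩ N y, p w + (Z' \ S).card * (A / ε) := by
          rw [Finset.sum_add_distrib, ← Finset.mul_sum, Finset.sum_const, nsmul_eq_mul]
      _ ≤ (1 + ε) * (ε * μ + κ * load M (F ∩ Z)) + ε * vol := by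
          refine add_le_add (mul_le_mul_of_nonneg_left (le_trans ?_ h2) (by linarith))
            (le_trans (mul_le_mul_of_nonneg_right hm (by positivity)) hmε)
          exact Finset.sum_le_sum_of_subset_of_nonneg Finset.sdiff_subset
            fun _ _ _ => Finset.sum_nonneg fun w _ => hp0 w
  have h6 : ∑ y ∈ Z', ((N y ∩ X).card : ℝ)
      = ∑ y ∈ Z' ∩ S, ((N y ∩ X).card : ℝ) + ∑ y ∈ Z' \ S, ((N y ∩ X).card : ℝ) :=
    (Finset.sum_inter_add_sum_sdiff Z' S _).symm
  -- the share of `Z` in the load of `F` is hardly larger than its share in the total load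
  have h7 : load M (F ∩ Z) ≤ load M Z - load M H := by
    rw [← load_sdiff M hHZ]
    refine load_mono M fun w hw => ?_
    rw [Finset.mem_inter] at hw
    exact Finset.mem_sdiff.2 ⟨hw.2, Finset.disjoint_left.1 hFH hw.1⟩
  have h8 : (1 - ε) * load M (F ∩ Z) ≤ s * load M F := by
    have hH0 := load_nonneg M H
    nlinarith [mul_le_mul_of_nonneg_left hF hs0]
  have h9 : (1 - ε) * (κ * load M F) ≤ μ := load_le_sum_hitProb hN hM hA hε hκ hFS hMS
  have h14 : (1 - ε) ^ 3 * (κ * load M (F ∩ Z)) ≤ s * vol := by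
    have hκ0 : (0 : ℝ) ≤ κ := Nat.cast_nonneg _
    have e1 : 0 ≤ 1 - ε := by linarith
    calc (1 - ε) ^ 3 * (κ * load M (F ∩ Z))
        = (1 - ε) ^ 2 * κ * ((1 - ε) * load M (F ∩ Z)) := by ring
      _ ≤ (1 - ε) ^ 2 * κ * (s * load M F) := by gcongr
      _ = s * (1 - ε) * ((1 - ε) * (κ * load M F)) := by ring
      _ ≤ s * (1 - ε) * μ := by gcongr
      _ = s * ((1 - ε) * μ) := by ring
      _ ≤ s * vol := by gcongr
  have hc : κ * load M (F ∩ Z) ≤ (1 + 4 * ε) * (s * vol) := by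
    have e1 : 1 ≤ (1 + 4 * ε) * (1 - ε) ^ 3 := by
      have : (1 + 4 * ε) * (1 - ε) ^ 3 = 1 + ε * (1 - 9 * ε + 11 * ε ^ 2 - 4 * ε ^ 3) := by ring
      rw [this]
      have : 0 ≤ ε * (1 - 9 * ε + 11 * ε ^ 2 - 4 * ε ^ 3) := by
        apply mul_nonneg hε.le
        have e3 : ε ^ 3 ≤ ε ^ 2 := pow_le_pow_of_le_one hε.le (by linarith) (by norm_num)
        linarith [sq_nonneg ε]
      linarith
    have e2 : 0 ≤ κ * load M (F ∩ Z) := mul_nonneg (Nat.cast_nonneg _) (load_nonneg _ _)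
    calc κ * load M (F ∩ Z) ≤ (1 + 4 * ε) * (1 - ε) ^ 3 * (κ * load M (F ∩ Z)) :=
          le_mul_of_one_le_left e2 e1
      _ = (1 + 4 * ε) * ((1 - ε) ^ 3 * (κ * load M (F ∩ Z))) := by ring
      _ ≤ _ := by gcongr
  have hμv : μ ≤ 2 * vol := by
    have : ε * μ ≤ 1 / 1000 * μ := by gcongr
    linarith
  have hsv : s * vol ≤ 1 / 8 * vol := by gcongr
  have hεv : 0 ≤ ε * vol := by positivity
  have hsv0 : 0 ≤ s * vol := by positivity
  have hf1 : (1 + ε) * (ε * μ + κ * load M (F ∩ Z)) ≤ (1 + ε) * (ε * (2 * vol)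
      + (1 + 4 * ε) * (s * vol)) := by gcongr
  have hε2 : ε * ε ≤ 1 / 1000 * ε := by gcongr
  have hf3 : (1 + ε) * (1 + 4 * ε) * (s * vol) ≤ s * vol + ε * vol := by
    calc (1 + ε) * (1 + 4 * ε) * (s * vol) = (1 + 5 * ε + 4 * (ε * ε)) * (s * vol) := by ring
      _ ≤ (1 + 6 * ε) * (s * vol) := mul_le_mul_of_nonneg_right (by linarith) hsv0
      _ = s * vol + 6 * ε * (s * vol) := by ring
      _ ≤ s * vol + 6 * ε * (1 / 8 * vol) := by gcongr
      _ ≤ s * vol + ε * vol := by linarith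
  have hf4 : (1 + ε) * (ε * (2 * vol)) ≤ 3 * (ε * vol) := by
    have : ε * (ε * vol) ≤ 1 / 1000 * (ε * vol) := by gcongr
    linarith
  rw [h6]
  have hf5 : (1 + ε) * (ε * (2 * vol) + (1 + 4 * ε) * (s * vol))
      = (1 + ε) * (ε * (2 * vol)) + (1 + ε) * (1 + 4 * ε) * (s * vol) := by ring
  linarith

end Contamination

end

/-! ### Parameters of the growth levels -/

section

section Parameters

/-- The relative precision at level `ℓ` of the growth process. The first three levels are
coarse, which makes them grow fast; the later ones are so fine that the errors of up to `q`
levels add up to a small constant. -/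
def precision (q : ℝ) (ℓ : ℕ) : ℝ := if ℓ < 3 then 1 / 1000 else 1 / (1000 * q)

/-- The logarithmic scale of the exceptional probabilities: single events fail with probability
at most `exp (-scale q)`. -/
def scale (q : ℝ) : ℝ := q / 10 ^ 6

/-- The number of the `K` calls that are used for sampling at level `ℓ`. -/
def sampleCalls (q : ℝ) (K ℓ : ℕ) : ℕ := ⌊precision q ℓ * K / scale q⌋₊

/-- The admissible fraction of the load inside the final set at level `ℓ`. -/
def tolerance (q : ℝ) (ℓ : ℕ) : ℝ := 1 / 16 + 8 * ∑ i ∈ Finset.range ℓ, precision q i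

variable {q : ℝ} {K : ℕ}

theorem precision_pos (hq : 10 ^ 6 ≤ q) (ℓ : ℕ) : 0 < precision q ℓ := by
  unfold precision; split_ifs <;> positivity

theorem precision_le (hq : 10 ^ 6 ≤ q) (ℓ : ℕ) : precision q ℓ ≤ 1 / 1000 := by
  unfold precision; split_ifs
  · rfl
  · apply one_div_le_one_div_of_le <;> linarith

theorem scale_pos (hq : 10 ^ 6 ≤ q) : 0 < scale q := by unfold scale; positivity

theorem tolerance_zero (q : ℝ) : tolerance q 0 = 1 / 16 := by simp [tolerance]

theorem tolerance_succ (q : ℝ) (ℓ : ℕ) :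
    tolerance q (ℓ + 1) = tolerance q ℓ + 8 * precision q ℓ := by
  unfold tolerance; rw [Finset.sum_range_succ]; ring

theorem tolerance_nonneg (hq : 10 ^ 6 ≤ q) (ℓ : ℕ) : 0 ≤ tolerance q ℓ := by
  have : 0 ≤ ∑ i ∈ Finset.range ℓ, precision q i :=
    Finset.sum_nonneg fun i _ => (precision_pos hq i).le
  unfold tolerance; linarith

theorem tolerance_le (hq : 10 ^ 6 ≤ q) {ℓ : ℕ} (hℓ : (ℓ : ℝ) ≤ q) : tolerance q ℓ ≤ 1 / 8 := by
  have h : ∑ i ∈ Finset.range ℓ, precision q i ≤ 3 / 1000 + ℓ * (1 / (1000 * q)) := by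
    clear hℓ
    induction ℓ with
    | zero => norm_num
    | succ ℓ ih =>
      rw [Finset.sum_range_succ]
      by_cases h3 : ℓ < 3
      · have h5 : ∀ i, precision q i ≤ 1 / 1000 := precision_le hq
        have h6 : ∑ i ∈ Finset.range (ℓ + 1), precision q i ≤ 3 / 1000 := by
          calc ∑ i ∈ Finset.range (ℓ + 1), precision q i
              ≤ ∑ i ∈ Finset.range (ℓ + 1), (1 / 1000 : ℝ) := Finset.sum_le_sum fun i _ => h5 i
            _ = (ℓ + 1 : ℕ) * (1 / 1000 : ℝ) := by simp
            _ ≤ 3 * (1 / 1000 : ℝ) := by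
              gcongr
              exact_mod_cast h3
            _ = 3 / 1000 := by norm_num
        rw [Finset.sum_range_succ] at h6
        have h4 : 0 ≤ ((ℓ + 1 : ℕ) : ℝ) * (1 / (1000 * q)) := by positivity
        linarith
      · have : precision q ℓ = 1 / (1000 * q) := if_neg h3
        rw [this]
        push_cast
        linarith
  have h2 : ℓ * (1 / (1000 * q)) ≤ 1 / 1000 := by
    rw [mul_one_div, div_le_div_iff₀ (by positivity) (by norm_num)]
    linarith
  unfold tolerance
  linarith

theorem sampleCalls_mul_scale_le (hq : 10 ^ 6 ≤ q) (ℓ : ℕ) :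
    sampleCalls q K ℓ * scale q ≤ precision q ℓ * K := by
  have hA := scale_pos hq
  have hε := precision_pos hq ℓ
  rw [← le_div_iff₀ hA]
  exact Nat.floor_le (by positivity)

theorem precision_mul_ge (hq : 10 ^ 6 ≤ q) (hK : q ^ 3 ≤ K) (ℓ : ℕ) :
    q ^ 2 / 1000 ≤ precision q ℓ * K := by
  have hq0 : 0 < q := by linarith
  have h1 : 1 / (1000 * q) ≤ precision q ℓ := by
    unfold precision; split_ifs
    · apply one_div_le_one_div_of_le <;> linarith
    · rfl
  calc q ^ 2 / 1000 = 1 / (1000 * q) * q ^ 3 := by field_simp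
    _ ≤ precision q ℓ * K := mul_le_mul h1 hK (by positivity) (precision_pos hq ℓ).le

theorem scale_le (hq : 10 ^ 6 ≤ q) (hK : q ^ 3 ≤ K) (ℓ : ℕ) :
    2 * scale q ≤ precision q ℓ * K := by
  refine le_trans ?_ (precision_mul_ge hq hK ℓ)
  unfold scale
  nlinarith

theorem le_sampleCalls (hq : 10 ^ 6 ≤ q) (hK : q ^ 3 ≤ K) (ℓ : ℕ) :
    precision q ℓ * K ≤ 2 * (sampleCalls q K ℓ * scale q) := by
  have hA := scale_pos hq
  have h1 : 1 ≤ precision q ℓ * K / scale q := by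
    rw [le_div_iff₀ hA]
    linarith [scale_le hq hK ℓ]
  have h2 := Nat.lt_floor_add_one (precision q ℓ * K / scale q)
  have h3 : (1 : ℝ) ≤ sampleCalls q K ℓ := by
    have : 1 ≤ sampleCalls q K ℓ := Nat.le_floor (by simpa using h1)
    exact_mod_cast this
  have h4 : precision q ℓ * K / scale q ≤ 2 * sampleCalls q K ℓ := by
    unfold sampleCalls at h3 ⊢
    linarith
  rw [div_le_iff₀ hA] at h4
  linarith

theorem sampleCalls_le (hq : 10 ^ 6 ≤ q) (ℓ : ℕ) : sampleCalls q K ℓ ≤ K := by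
  have hA := scale_pos hq
  have h1 := sampleCalls_mul_scale_le (K := K) hq ℓ
  have h2 := precision_le hq ℓ
  have h3 : (1 : ℝ) ≤ scale q := by unfold scale; linarith
  have h4 : (sampleCalls q K ℓ : ℝ) ≤ K := by
    have e1 : (0 : ℝ) ≤ K := Nat.cast_nonneg _
    have e2 : (0 : ℝ) ≤ sampleCalls q K ℓ := Nat.cast_nonneg _
    nlinarith
  exact_mod_cast h4

/-- Restarting at a node of large degree increases the potential. -/
theorem restart_growth (hq : 10 ^ 6 ≤ q) (hK : q ^ 3 ≤ K) (ℓ : ℕ) :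
    8 * (scale q * q)
      ≤ precision q ℓ ^ 2 * sampleCalls q K ℓ * q ^ min ℓ 3 := by
  have hq0 : 0 < q := by linarith
  have hA := scale_pos hq
  have hε := precision_pos hq ℓ
  have h1 := le_sampleCalls hq hK ℓ
  have h2 : (1 : ℝ) / 10 ^ 9 ≤ precision q ℓ ^ 3 * q ^ min ℓ 3 := by
    unfold precision
    split_ifs with h
    · have : 1 ≤ q ^ min ℓ 3 := one_le_pow₀ (by linarith)
      calc (1 : ℝ) / 10 ^ 9 = (1 / 1000) ^ 3 * 1 := by norm_num
        _ ≤ _ := by gcongr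
    · rw [min_eq_right (not_lt.1 h)]
      apply le_of_eq
      field_simp
      norm_num
  have h3 : 2 * scale q * (8 * (scale q * q)) ≤ 2 * scale q *
      (precision q ℓ ^ 2 * sampleCalls q K ℓ * q ^ min ℓ 3) := by
    calc 2 * scale q * (8 * (scale q * q)) ≤ 1 / 10 ^ 9 * q ^ 3 := by
          unfold scale
          have : 0 < q ^ 3 := by positivity
          ring_nf
          linarith
      _ ≤ precision q ℓ ^ 3 * q ^ min ℓ 3 * K := by gcongr
      _ = precision q ℓ ^ 2 * q ^ min ℓ 3 * (precision q ℓ * K) := by ring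
      _ ≤ precision q ℓ ^ 2 * q ^ min ℓ 3 * (2 * (sampleCalls q K ℓ * scale q)) := by gcongr
      _ = _ := by ring
  exact le_of_mul_le_mul_left h3 (by positivity)

/-- Passing to the next level increases the potential. -/
theorem level_growth (hq : 10 ^ 6 ≤ q) (hK : q ^ 3 ≤ K) (ℓ : ℕ) :
    5 * (q * q ^ min (ℓ + 1) 3) ≤ sampleCalls q K ℓ * q ^ min ℓ 3 := by
  have hq0 : 0 < q := by linarith
  have hA := scale_pos hq
  have h1 := le_sampleCalls hq hK ℓ
  by_cases h : ℓ < 3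
  · rw [min_eq_left (by omega : ℓ + 1 ≤ 3), min_eq_left h.le, pow_succ]
    have h2 : precision q ℓ = 1 / 1000 := if_pos h
    have h3 : 5 * q ^ 2 ≤ sampleCalls q K ℓ := by
      have : 2 * scale q * (5 * q ^ 2) ≤ 2 * scale q * sampleCalls q K ℓ := by
        rw [h2] at h1
        unfold scale at h1 ⊢
        have : 0 < q ^ 3 := by positivity
        nlinarith
      exact le_of_mul_le_mul_left this (by positivity)
    calc 5 * (q * (q ^ ℓ * q)) = 5 * q ^ 2 * q ^ ℓ := by ring
      _ ≤ _ := by gcongr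
  · rw [min_eq_right (by omega : 3 ≤ ℓ + 1), min_eq_right (not_lt.1 h)]
    have h3 : 5 * q ≤ sampleCalls q K ℓ := by
      have h2 := precision_mul_ge hq hK ℓ
      have : 2 * scale q * (5 * q) ≤ 2 * scale q * sampleCalls q K ℓ := by
        unfold scale at h1 ⊢
        nlinarith [sq_nonneg q]
      exact le_of_mul_le_mul_left this (by positivity)
    calc 5 * (q * q ^ 3) = 5 * q * q ^ 3 := by ring
      _ ≤ _ := by gcongr

end Parameters

end

/-! ### The probability that a phase stalls -/

section

variable {V : Type*} [Fintype V] [DecidableEq V]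

section Phase

variable {N : V → Finset V} {K : ℕ}

theorem not_hits_of_not_mem_step {S : Finset V} {y : V → Fin K → V} {w : V}
    (h : w ∉ step S y) : ¬Hits K (fun v => N v ∩ S) y w := by
  rintro ⟨i, _, hi⟩
  exact h (mem_step.2 (Or.inr (Or.inr ⟨i, Finset.mem_of_mem_inter_right hi⟩)))

/-- With high probability, every node with a large fraction of informed neighbors pulls the
rumor in the next round. -/
theorem avg_exists_not_pulled (hN : ∀ v, (N v).Nonempty) (A : ℝ) (S : Finset V) :
    avg N K (fun y => ind (∃ w, A * (N w).card ≤ K * (N w ∩ S).card ∧ w ∉ step S y))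
      ≤ Fintype.card V * Real.exp (-A) := by
  refine (avg_mono fun y => ind_exists_le_sum _).trans ?_
  rw [avg_sum]
  have h : ∀ w, avg N K (fun y => ind (A * (N w).card ≤ K * (N w ∩ S).card ∧ w ∉ step S y))
      ≤ Real.exp (-A) := by
    intro w
    by_cases hw : A * (N w).card ≤ K * ((N w ∩ S).card : ℝ)
    · refine (avg_mono fun y => ind_mono (Q := ∀ v ∈ ({w} : Finset V),
        ¬Hits K (fun v => N v ∩ S) y v) ?_).trans ?_
      · rintro ⟨_, h⟩ v hv
        rw [Finset.mem_singleton] at hv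
        exact hv ▸ not_hits_of_not_mem_step h
      · refine (avg_ind_forall_not_hits hN (fun v => Finset.inter_subset_left) _).trans ?_
        rw [Real.exp_le_exp, neg_le_neg_iff, Finset.sum_singleton, ← mul_div_assoc,
          le_div_iff₀ (Nat.cast_pos.2 (hN w).card_pos)]
        exact hw
    · have : ∀ y : V → Fin K → V,
          ind (A * (N w).card ≤ K * ((N w ∩ S).card : ℝ) ∧ w ∉ step S y) = 0 :=
        fun y => ind_of_not fun h => hw h.1
      simp only [this]
      rw [avg_const hN]
      exact (Real.exp_pos _).le
  refine (Finset.sum_le_sum fun w _ => h w).trans_eq ?_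
  rw [Finset.sum_const, nsmul_eq_mul, Finset.card_univ]

/-- Splitting off the first and the last of a sequence of rounds in a failure estimate. -/
theorem expect_le_of_first_last (hN : ∀ v, (N v).Nonempty) (S : Finset V) {T : ℕ}
    {P : List (V → Fin K → V) → Prop} {A a e : ℝ} (he : 0 ≤ e)
    {Bad : (V → Fin K → V) → Prop} (hBad : avg N K (fun x => ind (Bad x)) ≤ a)
    (h : ∀ x, ¬Bad x → ∃ Q : List (V → Fin K → V) → Prop,
      expect N K T (fun l => ind (Q l)) ≤ e ∧ ∀ l y, P (x :: (l ++ [y])) → Q l ∨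
        ∃ w, A * (N w).card ≤ K * ((N w ∩ spread (step S x) l).card : ℝ) ∧
          w ∉ step (spread (step S x) l) y) :
    expect N K (T + 2) (fun l => ind (P l)) ≤ a + e + Fintype.card V * Real.exp (-A) := by
  have hc : 0 ≤ (Fintype.card V : ℝ) * Real.exp (-A) := by positivity
  have h1 : ∀ x, expect N K (T + 1) (fun l => ind (P (x :: l)))
      ≤ ind (Bad x) + (e + Fintype.card V * Real.exp (-A)) := by
    intro x
    by_cases hx : Bad x
    · rw [ind_of hx]
      have : expect N K (T + 1) (fun l => ind (P (x :: l))) ≤ 1 :=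
        (expect_mono fun l => ind_le_one _).trans_eq (expect_const hN _ 1)
      linarith
    · obtain ⟨Q, hQ, hPQ⟩ := h x hx
      rw [ind_of_not hx, zero_add, expect_succ_last]
      have h2 : ∀ l, avg N K (fun y => ind (P (x :: (l ++ [y]))))
          ≤ ind (Q l) + Fintype.card V * Real.exp (-A) := by
        intro l
        refine (avg_mono fun y => ind_le_add (hPQ l y)).trans ?_
        rw [avg_add, avg_const hN]
        linarith [avg_exists_not_pulled (K := K) hN A (spread (step S x) l)]
      refine (expect_mono h2).trans ?_
      rw [expect_add, expect_const hN]
      linarith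
  refine (avg_mono h1).trans ?_
  rw [avg_add, avg_const hN]
  linarith

omit [DecidableEq V] in
theorem load_le (M : V → Finset V) (Z : Finset V) : load M Z ≤ (Fintype.card V : ℝ) ^ 2 := by
  calc load M Z ≤ load M Finset.univ := load_mono M (Finset.subset_univ _)
    _ ≤ ∑ _w : V, (Fintype.card V : ℝ) :=
      Finset.sum_le_sum fun w _ => by exact_mod_cast Finset.card_le_univ _
    _ = _ := by rw [Finset.sum_const, nsmul_eq_mul, Finset.card_univ]; ring

/-- The failure event of a phase: few new nodes are informed in the end, and only a small
fraction of the load of `M` lies in the final set `Z`. -/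
def Stalls (S : Finset V) (M : V → Finset V) (u s : ℝ) (Z : Finset V) : Prop :=
  ((Z \ S).card : ℝ) < u / 64 ∧ load M Z ≤ s * load M Finset.univ

omit [Fintype V] in
theorem Stalls.mono_left {S S' Z Z' : Finset V} {u : ℝ} (h : ((Z \ S).card : ℝ) < u / 64)
    (hS : S ⊆ S') (hZ : Z' ⊆ Z) : ((Z' \ S').card : ℝ) < u / 64 := by
  refine lt_of_le_of_lt ?_ h
  exact_mod_cast Finset.card_le_card (Finset.sdiff_subset_sdiff hZ hS)

omit [Fintype V] in
theorem load_singleton (hs : ∀ u v, u ∈ N v → v ∈ N u) (z : V) (Z : Finset V) :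
    load (fun w => if z ∈ N w then {z} else ∅) Z = ((N z ∩ Z).card : ℝ) := by
  unfold load
  have h : ∀ w, (((if z ∈ N w then {z} else ∅ : Finset V)).card : ℝ)
      = if w ∈ N z then 1 else 0 := by
    intro w
    by_cases hw : z ∈ N w
    · rw [if_pos hw, if_pos (hs _ _ hw)]; simp
    · rw [if_neg hw, if_neg fun h => hw (hs _ _ h)]; simp
  simp only [h]
  rw [Finset.sum_ite_mem, Finset.inter_comm]
  simp

set_option maxHeartbeats 4000000 in
/-- The growth and backtracking argument. The state of the process is a set `S` of informed
nodes, and for every node `w` a set `M w` of informed neighbors from which `w` may learn the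
rumor; the total load of `M` grows from one level to the next until it exceeds `n²`, which is
impossible. Each step forward uses one round at the start, and one round at the end in which
the contamination of the final set is passed back by one level.

If the nodes of large degree carry a share of the load, then one of them has to be informed by a
push, after which the growth restarts at level `0` with the neighborhood of that node. The first
alternative in the hypotheses says that pushes from `S` hit a set in proportion to its load; the
second one says that the degree `n` is not large in this sense, so that no such node exists. -/
theorem expect_stalls_le (hN : ∀ v, (N v).Nonempty) (hs : ∀ u v, u ∈ N v → v ∈ N u)
    {q u : ℝ} (hq : 10 ^ 6 ≤ q) (hK : q ^ 3 ≤ K) (hu : 0 < u) (r : ℕ) :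
    ∀ (ℓ : ℕ) (S : Finset V) (M : V → Finset V), (∀ w, M w ⊆ N w ∩ S) →
      ((∀ F, load M F ≤ 2 * load M Finset.univ * ∑ x ∈ S, ((N x ∩ F).card : ℝ) / (N x).card) ∨
        Fintype.card V * (8 * scale q)
          < precision q ℓ ^ 2 * sampleCalls q K ℓ * load M Finset.univ) →
      ((ℓ + r : ℕ) : ℝ) ≤ q → q ^ min ℓ 3 * u ≤ load M Finset.univ →
      (Fintype.card V : ℝ) ^ 2 * q ^ min ℓ 3 < load M Finset.univ * q ^ r →
      expect N K (2 * r) (fun l => ind (Stalls S M u (tolerance q ℓ) (spread S l)))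
        ≤ r * ((3 * Fintype.card V + 2) * Real.exp (-scale q)) := by
  have hq1 : 1 ≤ q := by linarith
  have hq0 : 0 < q := by linarith
  have hA := scale_pos hq
  have hD : ∀ w, (0 : ℝ) < (N w).card := fun w => Nat.cast_pos.2 (hN w).card_pos
  induction r with
  | zero =>
    intro ℓ S M _ _ _ _ h
    have h1 : 1 ≤ q ^ min ℓ 3 := one_le_pow₀ hq1
    have h2 := load_le M Finset.univ
    have h3 : (Fintype.card V : ℝ) ^ 2 * 1 ≤ (Fintype.card V : ℝ) ^ 2 * q ^ min ℓ 3 := by gcongr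
    rw [pow_zero] at h
    linarith
  | succ r ih =>
    intro ℓ S M hM hpush hℓ hmass hpot
    set ε := precision q ℓ with hεdef
    set A := scale q with hAdef
    set κ := sampleCalls q K ℓ with hκdef
    set t := q ^ min ℓ 3 with ht
    set m := load M Finset.univ with hm
    set s := tolerance q ℓ with hsdef
    set p := (3 * (Fintype.card V : ℝ) + 2) * Real.exp (-A) with hp
    have hE := Real.exp_pos (-A)
    have hn0 : (0 : ℝ) ≤ Fintype.card V := Nat.cast_nonneg _
    have hp0 : 0 ≤ p := by positivity
    have hnE : 0 ≤ Fintype.card V * Real.exp (-A) := by positivity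
    have hpE : p = 3 * (Fintype.card V * Real.exp (-A)) + 2 * Real.exp (-A) := by rw [hp]; ring
    have hε : 0 < ε := precision_pos hq ℓ
    have hε1 : ε ≤ 1 / 1000 := precision_le hq ℓ
    have ht1 : 1 ≤ t := one_le_pow₀ hq1
    have hm0 : 0 < m := lt_of_lt_of_le (by positivity) hmass
    have hκA : κ * A ≤ ε * K := sampleCalls_mul_scale_le hq ℓ
    have hAK : 2 * A ≤ ε * K := scale_le hq hK ℓ
    have hK0' : (0 : ℝ) < K := lt_of_lt_of_le (by positivity) hK
    have hK0 : 0 < K := Nat.cast_pos.1 hK0'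
    have hrestart : 8 * (A * q) ≤ ε ^ 2 * κ * t := restart_growth hq hK ℓ
    have hlevel : 5 * (q * q ^ min (ℓ + 1) 3) ≤ κ * t := level_growth hq hK ℓ
    have hℓq : (ℓ : ℝ) ≤ q := by
      refine le_trans ?_ hℓ
      exact_mod_cast Nat.le_add_right _ _
    have hs1 : s ≤ 1 / 8 := tolerance_le hq hℓq
    have hs0 : 0 ≤ s := tolerance_nonneg hq ℓ
    have hMN : ∀ w, M w ⊆ N w := fun w => (hM w).trans Finset.inter_subset_left
    have hMS : ∀ w, M w ⊆ S := fun w => (hM w).trans Finset.inter_subset_right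
    -- nodes that pull the rumor immediately
    set H : Finset V := {w | A * (N w).card ≤ K * ((N w ∩ S).card : ℝ)} with hH
    have hHmem : ∀ w, w ∈ H ↔ A * (N w).card ≤ K * ((N w ∩ S).card : ℝ) := fun w => by
      simp [hH]
    -- nodes of large degree
    set B : ℝ := ε ^ 2 * κ * m / (8 * A) with hB
    set Big : Finset V := {w | B ≤ ((N w).card : ℝ)} with hBig
    have hBigmem : ∀ w, w ∈ Big ↔ B ≤ ((N w).card : ℝ) := fun w => by simp [hBig]
    have hBt : q * m ≤ B * t := by
      rw [hB, div_mul_eq_mul_div, le_div_iff₀ (by positivity)]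
      calc q * m * (8 * A) = m * (8 * (A * q)) := by ring
        _ ≤ m * (ε ^ 2 * κ * t) := by gcongr
        _ = _ := by ring
    have hBu : q * u ≤ B := by
      have : q * u * t ≤ B * t := by
        calc q * u * t = q * (t * u) := by ring
          _ ≤ q * m := by gcongr
          _ ≤ B * t := hBt
      exact le_of_mul_le_mul_right this (by linarith)
    have huB : u ≤ B := (le_mul_of_one_le_left hu.le hq1).trans hBu
    have hB0 : 0 < B := lt_of_lt_of_le (by positivity) hBu
    have hpulled := avg_exists_not_pulled (K := K) hN A S
    have hHstep : ∀ x : V → Fin K → V,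
        (¬∃ w, A * (N w).card ≤ K * ((N w ∩ S).card : ℝ) ∧ w ∉ step S x) →
        H ⊆ step S x := by
      intro x hx w hw
      by_contra h
      exact hx ⟨w, (hHmem w).1 hw, h⟩
    have hfin : ∀ (x : V → Fin K → V) l y,
        spread S (x :: (l ++ [y])) = step (spread (step S x) l) y := by
      intro x l y
      rw [spread_cons, spread_append]
      rfl
    have hrp : ((r + 1 : ℕ) : ℝ) * p = r * p + p := by push_cast; ring
    have hrp0 : 0 ≤ r * p := by positivity
    rw [show 2 * (r + 1) = 2 * r + 2 by ring, hrp]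
    by_cases hcase0 : s * m < load M H
    · -- too much load on nodes that pull the rumor anyway
      refine (expect_le_of_first_last (A := A) (e := 0) hN S le_rfl hpulled
        fun x hx => ⟨fun _ => False, ?_, ?_⟩).trans ?_
      · rw [show (fun _ : List (V → Fin K → V) => ind False) = fun _ => 0 from
          funext fun _ => ind_of_not not_false, expect_const hN]
      · rintro l y ⟨_, hst⟩
        exfalso
        rw [hfin] at hst
        have : load M H ≤ load M (step (spread (step S x) l) y) :=
          load_mono M (((hHstep x hx).trans (subset_spread _ _)).trans (subset_step _ _))
        linarith
      · linarith
    rw [not_lt] at hcase0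
    by_cases hcase1 : ε * m ≤ load M (Big \ H)
    · -- a node of large degree is informed by a push
      have hpush' : ∀ F, load M F ≤ 2 * m * ∑ x ∈ S, ((N x ∩ F).card : ℝ) / (N x).card := by
        rcases hpush with h | h
        · exact h
        · exfalso
          have hempty : Big = ∅ := by
            rw [Finset.eq_empty_iff_forall_notMem]
            intro w hw
            rw [hBigmem, hB, div_le_iff₀ (by positivity)] at hw
            have : ((N w).card : ℝ) ≤ Fintype.card V := by exact_mod_cast Finset.card_le_univ _
            have : ((N w).card : ℝ) * (8 * A) ≤ Fintype.card V * (8 * A) := by gcongr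
            linarith
          rw [hempty, Finset.empty_sdiff] at hcase1
          have : load M ∅ = 0 := by simp [load]
          rw [this] at hcase1
          have : 0 < ε * m := by positivity
          linarith
      have hsum : ε / 2 ≤ ∑ x ∈ S, ((N x ∩ (Big \ H)).card : ℝ) / (N x).card := by
        have h1 := hcase1.trans (hpush' (Big \ H))
        have h2 : m * (ε / 2) ≤ m * ∑ x ∈ S, ((N x ∩ (Big \ H)).card : ℝ) / (N x).card := by
          linarith
        exact le_of_mul_le_mul_left h2 hm0
      have hbad : avg N K (fun x => ind (∀ w ∈ S, ¬Hits K (fun w => N w ∩ (Big \ H)) x w))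
          ≤ Real.exp (-A) := by
        refine (avg_ind_forall_not_hits hN (fun w => Finset.inter_subset_left) S).trans ?_
        rw [Real.exp_le_exp, neg_le_neg_iff]
        calc A ≤ K * (ε / 2) := by linarith
          _ ≤ _ := by gcongr
      refine (expect_le_of_first_last (A := A) (e := r * p) hN S hrp0 hbad fun x hx => ?_).trans ?_
      · obtain ⟨w, hwS, i, _, hi⟩ : ∃ w ∈ S, Hits K (fun w => N w ∩ (Big \ H)) x w := by
          by_contra h
          exact hx fun w hw hh => h ⟨w, hw, hh⟩
        set z := x w i with hz
        have hzB : B ≤ ((N z).card : ℝ) :=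
          (hBigmem z).1 (Finset.mem_sdiff.1 (Finset.mem_inter.1 hi).2).1
        have hzH : (K : ℝ) * ((N z ∩ S).card : ℝ) < A * (N z).card := by
          have := (Finset.mem_sdiff.1 (Finset.mem_inter.1 hi).2).2
          rwa [hHmem, not_le] at this
        have hzS : z ∈ step S x := mem_step.2 (Or.inr (Or.inl ⟨w, hwS, i, rfl⟩))
        have hload : ∀ Z, load (fun w => if z ∈ N w then {z} else ∅) Z
            = ((N z ∩ Z).card : ℝ) := load_singleton hs z
        have hloadu : load (fun w => if z ∈ N w then {z} else ∅) Finset.univ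
            = ((N z).card : ℝ) := by rw [hload, Finset.inter_univ]
        refine ⟨fun l => Stalls (step S x) (fun w => if z ∈ N w then {z} else ∅) u
          (tolerance q 0) (spread (step S x) l), ?_, ?_⟩
        · refine ih 0 (step S x) _ ?_ (Or.inl ?_) ?_ ?_ ?_
          · intro v
            split_ifs with hv
            · exact Finset.singleton_subset_iff.2 (Finset.mem_inter.2 ⟨hv, hzS⟩)
            · exact Finset.empty_subset _
          · intro F
            rw [hload, hloadu]
            have h1 : ((N z ∩ F).card : ℝ) / (N z).card
                ≤ ∑ x ∈ step S x, ((N x ∩ F).card : ℝ) / (N x).card :=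
              Finset.single_le_sum (f := fun x => ((N x ∩ F).card : ℝ) / (N x).card)
                (fun _ _ => by positivity) hzS
            calc ((N z ∩ F).card : ℝ) = (N z).card * (((N z ∩ F).card : ℝ) / (N z).card) := by
                  field_simp [(hD z).ne']
              _ ≤ 2 * (N z).card * (((N z ∩ F).card : ℝ) / (N z).card) := by
                  gcongr
                  linarith [hD z]
              _ ≤ _ := by gcongr
          · refine le_trans ?_ hℓ
            exact_mod_cast (by omega : 0 + r ≤ ℓ + (r + 1))
          · rw [hloadu]
            simp only [zero_le, min_eq_left, pow_zero, one_mul]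
            exact huB.trans hzB
          · rw [hloadu]
            simp only [zero_le, min_eq_left, pow_zero, mul_one]
            have h1 : (Fintype.card V : ℝ) ^ 2 * t < (N z).card * q ^ r * t := by
              calc (Fintype.card V : ℝ) ^ 2 * t < m * q ^ (r + 1) := hpot
                _ = q * m * q ^ r := by ring
                _ ≤ B * t * q ^ r := by gcongr
                _ ≤ (N z).card * t * q ^ r := by gcongr
                _ = _ := by ring
            exact lt_of_mul_lt_mul_right h1 (by linarith)
        · rintro l y ⟨h1, _⟩
          left
          rw [hfin] at h1
          have h2 : ((spread (step S x) l \ S).card : ℝ) < u / 64 :=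
            Stalls.mono_left h1 subset_rfl (subset_step _ _)
          refine ⟨Stalls.mono_left h2 (subset_step S x) subset_rfl, ?_⟩
          rw [hload, hloadu, tolerance_zero]
          set Z' := spread (step S x) l
          have h3 : ((N z ∩ Z').card : ℝ) ≤ (N z ∩ S).card + (Z' \ S).card := by
            have : N z ∩ Z' ⊆ (N z ∩ S) ∪ (Z' \ S) := by
              intro v hv
              rw [Finset.mem_inter] at hv
              by_cases hvS : v ∈ S
              · exact Finset.mem_union_left _ (Finset.mem_inter.2 ⟨hv.1, hvS⟩)
              · exact Finset.mem_union_right _ (Finset.mem_sdiff.2 ⟨hv.2, hvS⟩)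
            exact_mod_cast (Finset.card_le_card this).trans (Finset.card_union_le _ _)
          have h4 : ((N z ∩ S).card : ℝ) ≤ 1 / 1000 * (N z).card := by
            have : (K : ℝ) * (N z ∩ S).card ≤ K * (1 / 1000 * (N z).card) := by
              have e1 : A ≤ 1 / 1000 * K := by
                have : ε * K ≤ 1 / 1000 * K := by gcongr
                linarith
              have := mul_le_mul_of_nonneg_right e1 (hD z).le
              linarith
            exact le_of_mul_le_mul_left this hK0'
          have h5 : u ≤ (N z).card := huB.trans hzB
          linarith
      · linarith
    rw [not_le] at hcase1
    -- the regular case: sampling from the nodes of moderate degree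
    set F : Finset V := (H ∪ Big)ᶜ with hF
    have hFH : Disjoint F H := by
      rw [hF, Finset.disjoint_left]
      intro w hw hwH
      rw [Finset.mem_compl] at hw
      exact hw (Finset.mem_union_left _ hwH)
    have hFB : ∀ w ∈ F, ((N w).card : ℝ) ≤ B := by
      intro w hw
      rw [hF, Finset.mem_compl, Finset.mem_union, not_or, hBigmem, not_le] at hw
      exact hw.2.le
    have hFS : ∀ w ∈ F, (K : ℝ) * (N w ∩ S).card < A * (N w).card := by
      intro w hw
      rw [hF, Finset.mem_compl, Finset.mem_union, not_or, hHmem, not_le] at hw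
      exact hw.1
    have hFload : (1 - ε) * m - load M H ≤ load M F := by
      have h1 : load M F = m - load M (H ∪ Big) := by
        rw [hm, ← load_sdiff M (Finset.subset_univ _), hF, Finset.compl_eq_univ_sdiff]
      have h2 : load M (H ∪ Big) = load M H + load M (Big \ H) := by
        have : Big \ H = (H ∪ Big) \ H := by
          ext w; simp only [Finset.mem_sdiff, Finset.mem_union]; tauto
        rw [this, load_sdiff M Finset.subset_union_left]
        ring
      linarith
    set μ := ∑ w ∈ F, ((N w).card : ℝ) * hitProb N κ M w with hμ
    have hμm : κ * m / 4 ≤ μ := by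
      have h1 : (1 - ε) * (κ * load M F) ≤ μ :=
        load_le_sum_hitProb hN hMN hA hε hκA hFS hMS
      have h2 : m / 2 ≤ load M F := by
        have e1 : ε * m ≤ 1 / 1000 * m := by gcongr
        have e2 : s * m ≤ 1 / 8 * m := by gcongr
        linarith
      have h3 : κ * (m / 2) ≤ κ * load M F := by gcongr
      have h4 : 0 ≤ κ * load M F := mul_nonneg (Nat.cast_nonneg _) (load_nonneg _ _)
      have h5 : ε * (κ * load M F) ≤ 1 / 1000 * (κ * load M F) := by gcongr
      linarith
    have hbad1 : avg N K (fun x => ind (∑ w ∈ F, ((N w).card : ℝ) * ind (Hits κ M x w)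
        < (1 - ε) * μ)) ≤ Real.exp (-A) := by
      refine (avg_ind_sum_hits_lt hN (sampleCalls_le hq ℓ) hMN F (fun w => ((N w).card : ℝ))
        (fun w _ => (hD w).le) hB0 hFB hε).trans ?_
      rw [Real.exp_le_exp, neg_le_neg_iff, le_div_iff₀ (by positivity), hB]
      calc A * (2 * (ε ^ 2 * κ * m / (8 * A))) = ε ^ 2 * (κ * m / 4) := by field_simp; ring
        _ ≤ _ := by gcongr
    have hbad2 : avg N K (fun x => ind (∃ y, (1 + ε) * ∑ w ∈ F ∩ N y, hitProb N κ M w + A / ε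
        < ∑ w ∈ F ∩ N y, ind (Hits κ M x w))) ≤ Fintype.card V * Real.exp (-A) := by
      refine (avg_mono fun x => ind_exists_le_sum _).trans ?_
      rw [avg_sum]
      refine (Finset.sum_le_sum fun y _ => avg_ind_lt_card_hits (A := A) hN
        (sampleCalls_le hq ℓ) hMN (F ∩ N y) hε (by linarith)).trans_eq ?_
      rw [Finset.sum_const, nsmul_eq_mul, Finset.card_univ]
    set Bad : (V → Fin K → V) → Prop := fun x =>
      (∃ w, A * (N w).card ≤ K * ((N w ∩ S).card : ℝ) ∧ w ∉ step S x) ∨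
      (∑ w ∈ F, ((N w).card : ℝ) * ind (Hits κ M x w) < (1 - ε) * μ) ∨
      ∃ y, (1 + ε) * ∑ w ∈ F ∩ N y, hitProb N κ M w + A / ε
        < ∑ w ∈ F ∩ N y, ind (Hits κ M x w) with hBad
    have hbad : avg N K (fun x => ind (Bad x)) ≤ (2 * Fintype.card V + 1) * Real.exp (-A) := by
      have h1 : ∀ x, ind (Bad x) ≤ ind (∃ w, A * (N w).card ≤ K * ((N w ∩ S).card : ℝ) ∧
          w ∉ step S x) + (ind (∑ w ∈ F, ((N w).card : ℝ) * ind (Hits κ M x w) < (1 - ε) * μ) +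
          ind (∃ y, (1 + ε) * ∑ w ∈ F ∩ N y, hitProb N κ M w + A / ε
            < ∑ w ∈ F ∩ N y, ind (Hits κ M x w))) := by
        intro x
        refine (ind_le_add (P := Bad x) fun h => h).trans ?_
        gcongr
        exact ind_le_add fun h => h
      refine (avg_mono h1).trans ?_
      rw [avg_add, avg_add]
      linarith
    refine (expect_le_of_first_last (A := A) (e := r * p) hN S hrp0 hbad fun x hx => ?_).trans ?_
    · rw [hBad] at hx
      simp only [not_or] at hx
      obtain ⟨hx1, hx2, hx3⟩ := hx
      have hHx := hHstep x hx1
      rw [not_lt] at hx2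
      classical
      set X : Finset V := F.filter fun w => Hits κ M x w with hX
      have hXF : X ⊆ F := Finset.filter_subset _ _
      have hXmem : ∀ w, w ∈ X ↔ w ∈ F ∧ Hits κ M x w := fun w => by simp [hX]
      have hXS : X ⊆ step S x := by
        intro w hw
        obtain ⟨i, _, hi⟩ := ((hXmem w).1 hw).2
        exact mem_step.2 (Or.inr (Or.inr ⟨i, hMS w hi⟩))
      have hsumX : ∀ (W : Finset V) (c : V → ℝ), W ⊆ F →
          ∑ w ∈ W, c w * ind (Hits κ M x w) = ∑ w ∈ W ∩ X, c w := by
        intro W c hW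
        rw [← Finset.sum_ite_mem]
        refine Finset.sum_congr rfl fun w hw => ?_
        by_cases h : Hits κ M x w
        · rw [ind_of h, if_pos ((hXmem w).2 ⟨hW hw, h⟩), mul_one]
        · rw [ind_of_not h, if_neg fun h' => h ((hXmem w).1 h').2, mul_zero]
      set vol := ∑ w ∈ X, ((N w).card : ℝ) with hvol
      have hvol1 : (1 - ε) * μ ≤ vol := by
        rw [hsumX F _ subset_rfl, Finset.inter_eq_right.2 hXF] at hx2
        exact hx2
      have hvol2 : κ * m / 5 ≤ vol := by
        have e0 : 0 ≤ κ * m := by positivity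
        have e1 : ε * (κ * m / 4) ≤ 1 / 1000 * (κ * m / 4) := by gcongr
        have e2 : (1 - ε) * (κ * m / 4) ≤ (1 - ε) * μ :=
          mul_le_mul_of_nonneg_left hμm (by linarith)
        linarith
      have hvolt : q * q ^ min (ℓ + 1) 3 * m ≤ vol * t := by
        have e1 : 5 * (q * q ^ min (ℓ + 1) 3) * m ≤ κ * t * m := by gcongr
        have e2 : κ * m / 5 * t ≤ vol * t := by gcongr
        linarith
      have hup : ∀ y, ((N y ∩ X).card : ℝ)
          ≤ (1 + ε) * ∑ w ∈ F ∩ N y, hitProb N κ M w + A / ε := by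
        intro y
        have h1 : ∑ w ∈ F ∩ N y, ind (Hits κ M x w) = ((N y ∩ X).card : ℝ) := by
          have h2 := hsumX (F ∩ N y) (fun _ => 1) Finset.inter_subset_left
          simp only [one_mul] at h2
          rw [h2, Finset.sum_const, nsmul_eq_mul, mul_one]
          congr 2
          ext w
          simp only [Finset.mem_inter]
          exact ⟨fun h => ⟨h.1.2, h.2⟩, fun h => ⟨⟨hXF h.2, h.1⟩, h.2⟩⟩
        by_contra h
        rw [not_le, ← h1] at h
        exact hx3 ⟨y, h⟩
      have hload : ∀ Z, load (fun y => N y ∩ X) Z = ∑ y ∈ Z, ((N y ∩ X).card : ℝ) :=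
        fun Z => rfl
      have hloadu : load (fun y => N y ∩ X) Finset.univ = vol := by
        rw [hload, sum_card_neighbors hs]
        simp only [Finset.inter_univ]
        rfl
      refine ⟨fun l => Stalls (step S x) (fun y => N y ∩ X) u (tolerance q (ℓ + 1))
        (spread (step S x) l), ?_, ?_⟩
      · refine ih (ℓ + 1) (step S x) _ ?_ (Or.inl ?_) ?_ ?_ ?_
        · intro v
          exact Finset.inter_subset_inter subset_rfl hXS
        · intro Y
          rw [hload, hloadu, sum_card_neighbors hs]
          calc ∑ w ∈ X, ((N w ∩ Y).card : ℝ)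
              ≤ ∑ w ∈ X, vol * (((N w ∩ Y).card : ℝ) / (N w).card) := by
                refine Finset.sum_le_sum fun w hw => ?_
                have h1 : ((N w).card : ℝ) ≤ vol :=
                  Finset.single_le_sum (f := fun w => ((N w).card : ℝ))
                    (fun _ _ => Nat.cast_nonneg _) hw
                calc ((N w ∩ Y).card : ℝ)
                    = (N w).card * (((N w ∩ Y).card : ℝ) / (N w).card) := by
                      field_simp [(hD w).ne']
                  _ ≤ _ := by gcongr
            _ = vol * ∑ w ∈ X, ((N w ∩ Y).card : ℝ) / (N w).card := by rw [Finset.mul_sum]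
            _ ≤ vol * ∑ w ∈ step S x, ((N w ∩ Y).card : ℝ) / (N w).card := by
                refine mul_le_mul_of_nonneg_left ?_ (Finset.sum_nonneg fun _ _ => by positivity)
                exact Finset.sum_le_sum_of_subset_of_nonneg hXS fun _ _ _ => by positivity
            _ ≤ 2 * vol * ∑ w ∈ step S x, ((N w ∩ Y).card : ℝ) / (N w).card := by
                have h1 : 0 ≤ vol := Finset.sum_nonneg fun _ _ => Nat.cast_nonneg _
                have h2 : 0 ≤ ∑ w ∈ step S x, ((N w ∩ Y).card : ℝ) / (N w).card :=
                  Finset.sum_nonneg fun _ _ => by positivity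
                linarith [mul_nonneg h1 h2]
        · refine le_trans (le_of_eq ?_) hℓ
          congr 1
          ring
        · rw [hloadu]
          have h1 : q ^ min (ℓ + 1) 3 * u * t ≤ vol * t := by
            calc q ^ min (ℓ + 1) 3 * u * t = 1 * q ^ min (ℓ + 1) 3 * (t * u) := by ring
              _ ≤ q * q ^ min (ℓ + 1) 3 * m := by gcongr
              _ ≤ vol * t := hvolt
          exact le_of_mul_le_mul_right h1 (by linarith)
        · rw [hloadu]
          have h0 : 0 < q ^ min (ℓ + 1) 3 := by positivity
          have h1 : (Fintype.card V : ℝ) ^ 2 * q ^ min (ℓ + 1) 3 * t < vol * q ^ r * t := by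
            calc (Fintype.card V : ℝ) ^ 2 * q ^ min (ℓ + 1) 3 * t
                = q ^ min (ℓ + 1) 3 * ((Fintype.card V : ℝ) ^ 2 * t) := by ring
              _ < q ^ min (ℓ + 1) 3 * (m * q ^ (r + 1)) := mul_lt_mul_of_pos_left hpot h0
              _ = q * q ^ min (ℓ + 1) 3 * m * q ^ r := by ring
              _ ≤ vol * t * q ^ r := by gcongr
              _ = _ := by ring
          exact lt_of_mul_lt_mul_right h1 (by linarith)
      · rintro l y ⟨h1, h2⟩
        rw [hfin] at h1 h2
        set Z' := spread (step S x) l with hZ'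
        by_cases hy : ∃ w, A * (N w).card ≤ K * ((N w ∩ Z').card : ℝ) ∧ w ∉ step Z' y
        · exact Or.inr hy
        left
        have h3 : ((Z' \ S).card : ℝ) < u / 64 :=
          Stalls.mono_left h1 subset_rfl (subset_step _ _)
        refine ⟨Stalls.mono_left h3 (subset_step S x) subset_rfl, ?_⟩
        rw [hloadu, hload, tolerance_succ]
        refine contamination_le hN hs hMN (Z := step Z' y) (m := u / 64) hA hε hε1 hs0 hs1 hK0
          hκA (by linarith) hFH hFS hMS hXF hvol1 hup hFload
          ((hHx.trans (subset_spread _ _)).trans (subset_step _ _)) ?_ h2 h3.le ?_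
        · intro w hw
          by_contra h
          exact hy ⟨w, not_lt.1 h, hw⟩
        · have e1 : u / 64 * A ≤ ε * vol * ε := by
            have e2 : 8 * (A * q) * u ≤ ε ^ 2 * κ * m := by
              calc 8 * (A * q) * u ≤ ε ^ 2 * κ * t * u := by gcongr
                _ = ε ^ 2 * κ * (t * u) := by ring
                _ ≤ _ := by gcongr
            have e3 : ε ^ 2 * (κ * m / 5) ≤ ε ^ 2 * vol := by gcongr
            have e4 : A * 1 * u ≤ A * q * u := by gcongr
            have e5 : 0 ≤ A * u := by positivity
            linarith
          rw [← mul_div_assoc, div_le_iff₀ hε]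
          exact e1
    · linarith

end Phase

end

/-! ### Rounds with few calls in place of one round with many -/

section

variable {V : Type*} [Fintype V] [DecidableEq V]

section Gain

variable {N : V → Finset V} {K : ℕ}

/-- A set `U` of uninformed nodes with informed neighbors lets the informed set grow by
`|U| / 64`. Either no informed node has more than `2 |U|` neighbors, or `K` is so large that
even the nodes of degree `n` in `U` are sampled reliably. -/
theorem expect_gain_le (hN : ∀ v, (N v).Nonempty) (hs : ∀ u v, u ∈ N v → v ∈ N u)
    {q : ℝ} (hq : 10 ^ 6 ≤ q) (hK : q ^ 3 ≤ K) {J : ℕ} (hJq : (J : ℝ) ≤ q)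
    (hJ : (Fintype.card V : ℝ) ^ 2 < q ^ J) {S U : Finset V} (hU : U.Nonempty)
    (hUS : Disjoint U S) (hnb : ∀ v ∈ U, ∃ x ∈ S, x ∈ N v)
    (hcond : (∀ x ∈ S, (N x).card ≤ 2 * U.card) ∨
      q ^ 2 * Fintype.card V ≤ K * U.card) :
    expect N K (2 * J) (fun l => ind (((spread S l \ S).card : ℝ) < U.card / 64))
      ≤ J * ((3 * Fintype.card V + 2) * Real.exp (-scale q)) := by
  have hU0 : (1 : ℝ) ≤ U.card := by exact_mod_cast hU.card_pos
  have hD : ∀ w, (0 : ℝ) < (N w).card := fun w => Nat.cast_pos.2 (hN w).card_pos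
  choose! f hfS hfN using hnb
  set M : V → Finset V := fun v => if v ∈ U then {f v} else ∅ with hM
  have hload : ∀ Z, load M Z = ((U ∩ Z).card : ℝ) := by
    intro Z
    have h : ∀ w, ((M w).card : ℝ) = if w ∈ U then 1 else 0 := by
      intro w
      simp only [hM]
      split_ifs <;> simp
    unfold load
    simp only [h]
    rw [Finset.sum_ite_mem, Finset.inter_comm]
    simp
  have hloadu : load M Finset.univ = U.card := by rw [hload, Finset.inter_univ]
  refine le_trans (expect_mono fun l => ind_mono fun h => ?_)
    (expect_stalls_le hN hs hq hK (by linarith : (0 : ℝ) < U.card) J 0 S M ?_ ?_ ?_ ?_ ?_)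
  · refine ⟨h, ?_⟩
    rw [hload, hloadu, tolerance_zero]
    have h1 : ((U ∩ spread S l).card : ℝ) ≤ (spread S l \ S).card := by
      refine Nat.cast_le.2 (Finset.card_le_card fun v hv => ?_)
      rw [Finset.mem_inter] at hv
      exact Finset.mem_sdiff.2 ⟨hv.2, Finset.disjoint_left.1 hUS hv.1⟩
    linarith
  · intro w
    simp only [hM]
    split_ifs with hw
    · exact Finset.singleton_subset_iff.2 (Finset.mem_inter.2 ⟨hfN w hw, hfS w hw⟩)
    · exact Finset.empty_subset _
  · rcases hcond with h | h
    · left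
      intro F
      rw [hload, hloadu]
      calc ((U ∩ F).card : ℝ) = ∑ v ∈ U ∩ F, (1 : ℝ) := by simp
        _ ≤ ∑ v ∈ U ∩ F, ((N v ∩ S).card : ℝ) := by
            refine Finset.sum_le_sum fun v hv => ?_
            have hvU := Finset.mem_of_mem_inter_left hv
            exact_mod_cast Finset.card_pos.2 ⟨f v, Finset.mem_inter.2 ⟨hfN v hvU, hfS v hvU⟩⟩
        _ ≤ ∑ v ∈ F, ((N v ∩ S).card : ℝ) :=
            Finset.sum_le_sum_of_subset_of_nonneg Finset.inter_subset_right
              fun _ _ _ => Nat.cast_nonneg _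
        _ = ∑ x ∈ S, ((N x ∩ F).card : ℝ) := sum_card_neighbors hs S F
        _ ≤ ∑ x ∈ S, 2 * U.card * (((N x ∩ F).card : ℝ) / (N x).card) := by
            refine Finset.sum_le_sum fun x hx => ?_
            have h1 : ((N x).card : ℝ) ≤ 2 * U.card := by exact_mod_cast h x hx
            calc ((N x ∩ F).card : ℝ) = (N x).card * (((N x ∩ F).card : ℝ) / (N x).card) := by
                  field_simp [(hD x).ne']
              _ ≤ _ := by gcongr
        _ = _ := by rw [Finset.mul_sum]
    · right
      rw [hloadu]
      have hA := scale_pos hq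
      have h1 := le_sampleCalls hq hK 0
      have h0 : precision q 0 = 1 / 1000 := if_pos (by norm_num)
      rw [h0] at h1 ⊢
      have hn : (1 : ℝ) ≤ Fintype.card V :=
        hU0.trans (by exact_mod_cast Finset.card_le_univ U)
      set κ : ℝ := (sampleCalls q K 0 : ℝ)
      have hq0 : 0 < q := by linarith
      have h2 : 2 * scale q * (Fintype.card V * (8 * scale q))
          < 2 * scale q * ((1 / 1000) ^ 2 * κ * U.card) := by
        have e1 : 2 * scale q * (Fintype.card V * (8 * scale q))
            = 16 / 10 ^ 12 * (q ^ 2 * Fintype.card V) := by unfold scale; ring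
        have e2 : (1 / 1000) ^ 2 * (U.card * (1 / 1000 * (K : ℝ)))
            ≤ (1 / 1000) ^ 2 * (U.card * (2 * (κ * scale q))) := by gcongr
        have e3 : 0 < q ^ 2 * (Fintype.card V : ℝ) := by positivity
        linarith
      exact lt_of_mul_lt_mul_left h2 (by positivity)
  · rwa [zero_add]
  · simp [hloadu]
  · rw [hloadu]
    simp only [zero_le, min_eq_left, pow_zero, mul_one]
    have : 0 < q ^ J := by have : 0 < q := by linarith
                           positivity
    nlinarith

end Gain

section Coupling

variable {N : V → Finset V}

theorem sum_outcomes_add (N : V → Finset V) (a b : ℕ) (f : (V → Fin (a + b) → V) → ℝ) :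
    ∑ x ∈ outcomes N (a + b), f x
      = ∑ x ∈ outcomes N a, ∑ y ∈ outcomes N b, f fun v => Fin.append (x v) (y v) := by
  rw [← Finset.sum_product']
  symm
  refine Finset.sum_nbij' (fun p v => Fin.append (p.1 v) (p.2 v))
    (fun z => (fun v i => z v (Fin.castAdd b i), fun v i => z v (Fin.natAdd a i)))
    ?_ ?_ ?_ ?_ ?_
  · rintro ⟨x, y⟩ h
    simp only [outcomes, Finset.mem_product, Fintype.mem_piFinset] at h ⊢
    intro v i
    refine Fin.addCases (fun i => ?_) (fun i => ?_) i
    · rw [Fin.append_left]; exact h.1 v i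
    · rw [Fin.append_right]; exact h.2 v i
  · intro z h
    simp only [outcomes, Finset.mem_product, Fintype.mem_piFinset] at h ⊢
    exact ⟨fun v i => h v _, fun v i => h v _⟩
  · rintro ⟨x, y⟩ _
    simp
  · intro z _
    funext v i
    refine Fin.addCases (fun i => ?_) (fun i => ?_) i
    · rw [Fin.append_left]
    · rw [Fin.append_right]
  · rintro ⟨x, y⟩ _
    rfl

theorem avg_add_calls (a b : ℕ) (f : (V → Fin (a + b) → V) → ℝ) :
    avg N (a + b) f = avg N a fun x => avg N b fun y => f fun v => Fin.append (x v) (y v) := by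
  have h1 := sum_outcomes_add N a b fun _ => (1 : ℝ)
  simp only [Finset.sum_const, nsmul_eq_mul, mul_one] at h1
  unfold avg
  rw [sum_outcomes_add, h1, ← Finset.sum_div, div_div, mul_comm]

/-- Making `a + b` calls at once informs no more nodes than making them in two rounds. -/
theorem step_append_subset {a b : ℕ} (I : Finset V) (x : V → Fin a → V) (y : V → Fin b → V) :
    step I (fun v => Fin.append (x v) (y v)) ⊆ step (step I x) y := by
  intro v hv
  rw [mem_step] at hv
  rcases hv with hv | ⟨u, hu, i, hi⟩ | ⟨i, hi⟩
  · exact subset_step _ _ (subset_step _ _ hv)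
  · revert hi
    refine Fin.addCases (fun i hi => ?_) (fun i hi => ?_) i
    · rw [Fin.append_left] at hi
      exact subset_step _ _ (mem_step.2 (Or.inr (Or.inl ⟨u, hu, i, hi⟩)))
    · rw [Fin.append_right] at hi
      exact mem_step.2 (Or.inr (Or.inl ⟨u, subset_step _ _ hu, i, hi⟩))
  · revert hi
    refine Fin.addCases (fun i hi => ?_) (fun i hi => ?_) i
    · rw [Fin.append_left] at hi
      exact subset_step _ _ (mem_step.2 (Or.inr (Or.inr ⟨i, hi⟩)))
    · rw [Fin.append_right] at hi
      exact mem_step.2 (Or.inr (Or.inr ⟨i, subset_step _ _ hi⟩))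

theorem avg_step_le_expect (hN : ∀ v, (N v).Nonempty) (k a : ℕ) :
    ∀ (g : Finset V → ℝ), Monotone g → ∀ I : Finset V,
      avg N (a * k) (fun x => g (step I x)) ≤ expect N k a fun l => g (spread I l) := by
  induction a with
  | zero =>
    intro g _ I
    rw [Nat.zero_mul]
    have h : ∀ x : V → Fin 0 → V, step I x = I := by
      intro x
      ext v
      rw [mem_step]
      simp
    simp only [h]
    rw [avg_const hN]
    exact le_rfl
  | succ a ih =>
    intro g hg I
    rw [Nat.succ_mul, avg_add_calls, expect_succ_last]
    calc _ ≤ avg N (a * k) fun x => (fun J => avg N k fun y => g (step J y)) (step I x) :=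
          avg_mono fun x => avg_mono fun y => hg (step_append_subset I x y)
      _ ≤ expect N k a fun l => (fun J => avg N k fun y => g (step J y)) (spread I l) :=
          ih _ (fun J J' h => avg_mono fun y => hg (step_mono h y)) I
      _ = _ := by
          simp only [spread_append]
          rfl

/-- Rounds with `a * k` calls are dominated by `a` times as many rounds with `k` calls. -/
theorem expect_mul_calls_le (hN : ∀ v, (N v).Nonempty) (k a T : ℕ) {g : Finset V → ℝ}
    (hg : Monotone g) (I : Finset V) :
    expect N (a * k) T (fun l => g (spread I l))
      ≤ expect N k (T * a) fun l => g (spread I l) := by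
  induction T generalizing I with
  | zero => rw [Nat.zero_mul]; exact le_rfl
  | succ T ih =>
    rw [Nat.succ_mul, add_comm (T * a) a, expect_append a (T * a)]
    calc expect N (a * k) (T + 1) (fun l => g (spread I l))
        ≤ avg N (a * k) fun x => (fun J => expect N k (T * a) fun l => g (spread J l))
            (step I x) := avg_mono fun x => ih _
      _ ≤ expect N k a fun l => (fun J => expect N k (T * a) fun l => g (spread J l))
            (spread I l) :=
          avg_step_le_expect hN k a _ (fun J J' h => expect_mono fun l => hg (spread_mono h l)) I
      _ = _ := by simp only [spread_append]

/-- The probability that the set informed after `T` rounds, from `I`, has the property `Q`. -/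
def reach (N : V → Finset V) (k T : ℕ) (I : Finset V) (Q : Finset V → Prop) : ℝ :=
  expect N k T fun l => ind (Q (spread I l))

theorem reach_of (hN : ∀ v, (N v).Nonempty) {k T : ℕ} {I : Finset V} {Q : Finset V → Prop}
    (hQ : ∀ J, I ⊆ J → Q J) : reach N k T I Q = 1 := by
  unfold reach
  rw [show (fun l : List (V → Fin k → V) => ind (Q (spread I l))) = fun _ => 1 from
    funext fun l => ind_of (hQ _ (subset_spread I l)), expect_const hN]

/-- Composition of phases: the probabilities of failure add up. -/
theorem reach_add_le (hN : ∀ v, (N v).Nonempty) {k T T' : ℕ} {I : Finset V}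
    {Q Q' : Finset V → Prop} {e e' : ℝ} (he' : 0 ≤ e') (h : 1 - e ≤ reach N k T I Q)
    (h' : ∀ J, I ⊆ J → Q J → 1 - e' ≤ reach N k T' J Q') :
    1 - (e + e') ≤ reach N k (T + T') I Q' := by
  have h1 : ∀ l : List (V → Fin k → V),
      ind (Q (spread I l)) + (-e') ≤ expect N k T' fun l' => ind (Q' (spread I (l ++ l'))) := by
    intro l
    by_cases hQ : Q (spread I l)
    · have := h' _ (subset_spread I l) hQ
      rw [ind_of hQ]
      simp only [spread_append]
      unfold reach at this
      linarith
    · rw [ind_of_not hQ]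
      have : 0 ≤ expect N k T' fun l' => ind (Q' (spread I (l ++ l'))) :=
        (expect_const hN T' 0).symm.le.trans (expect_mono fun l => ind_nonneg _)
      linarith
  have h2 := expect_mono (N := N) (T := T) h1
  rw [expect_add, expect_const hN] at h2
  unfold reach at h ⊢
  rw [expect_append]
  linarith

theorem reach_mono_time (hN : ∀ v, (N v).Nonempty) {k T T' : ℕ} (hT : T ≤ T') {I : Finset V}
    {Q : Finset V → Prop} (hQ : ∀ J J', J ⊆ J' → Q J → Q J') :
    reach N k T I Q ≤ reach N k T' I Q := by
  obtain ⟨S, rfl⟩ := Nat.exists_eq_add_of_le hT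
  have := reach_add_le hN (k := k) (T := T) (T' := S) (I := I) (Q := Q) (Q' := Q)
    (e := 1 - reach N k T I Q) le_rfl (by linarith)
    (fun J _ hJ => by rw [reach_of hN fun J' hJJ => hQ _ _ hJJ hJ]; linarith)
  linarith

/-- `expect_gain_le` for `a` successive rounds in place of one. -/
theorem le_reach_gain (hN : ∀ v, (N v).Nonempty) (hs : ∀ u v, u ∈ N v → v ∈ N u)
    {q : ℝ} (hq : 10 ^ 6 ≤ q) {k a : ℕ} (hK : q ^ 3 ≤ (a * k : ℕ)) {J : ℕ} (hJq : (J : ℝ) ≤ q)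
    (hJ : (Fintype.card V : ℝ) ^ 2 < q ^ J) {S U : Finset V} (hU : U.Nonempty)
    (hUS : Disjoint U S) (hnb : ∀ v ∈ U, ∃ x ∈ S, x ∈ N v)
    (hcond : (∀ x ∈ S, (N x).card ≤ 2 * U.card) ∨
      q ^ 2 * Fintype.card V ≤ (a * k : ℕ) * U.card) :
    1 - J * ((3 * Fintype.card V + 2) * Real.exp (-scale q))
      ≤ reach N k (2 * J * a) S fun Z => (S.card : ℝ) + U.card / 64 ≤ Z.card := by
  have h1 := expect_gain_le hN hs hq hK hJq hJ hU hUS hnb hcond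
  have h2 := expect_mul_calls_le hN k a (2 * J)
    (g := fun Z => ind ((S.card : ℝ) + U.card / 64 ≤ Z.card))
    (fun Z Z' h => ind_mono fun hZ => hZ.trans (by exact_mod_cast Finset.card_le_card h)) S
  have h3 : ∀ l : List (V → Fin (a * k) → V), 1 ≤ ind ((S.card : ℝ) + U.card / 64
      ≤ (spread S l).card) + ind (((spread S l \ S).card : ℝ) < U.card / 64) := by
    intro l
    have h4 : ((spread S l).card : ℝ) = (spread S l \ S).card + S.card := by
      rw [← Nat.cast_add, Finset.card_sdiff_add_card_eq_card (subset_spread S l)]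
    have := ind_le_add (P := True) (Q := (S.card : ℝ) + U.card / 64 ≤ (spread S l).card)
      (R := ((spread S l \ S).card : ℝ) < U.card / 64) fun _ => by
        rw [h4]
        rcases lt_or_ge ((spread S l \ S).card : ℝ) (U.card / 64) with h | h
        · exact Or.inr h
        · left; linarith
    rwa [ind_of trivial] at this
  have h5 := expect_mono (N := N) (T := 2 * J) h3
  rw [expect_const hN, expect_add] at h5
  unfold reach
  linarith

end Coupling

end

/-! ### Growth to more than half of the nodes -/

section

variable {V : Type*} [Fintype V] [DecidableEq V]

section Half

variable (G : SimpleGraph V) [DecidableRel G.Adj]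

omit [DecidableEq V] in
theorem callees_symm {u v : V} (h : u ∈ callees G v) : v ∈ callees G u := by
  unfold callees at h ⊢
  split_ifs at h with hv
  · have hadj : G.Adj v u := by simpa using h
    have hu : v ∈ G.neighborFinset u := by simpa using hadj.symm
    rwa [if_pos ⟨v, hu⟩]
  · rw [Finset.mem_singleton] at h
    subst h
    rw [if_neg hv]
    exact Finset.mem_singleton_self _

omit [DecidableEq V] in
theorem mem_callees_of_adj {u v : V} (h : G.Adj u v) : u ∈ callees G v := by
  have hu : u ∈ G.neighborFinset v := by simpa using h.symm
  unfold callees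
  rwa [if_pos ⟨u, hu⟩]

theorem mem_boundary {S : Finset V} {v : V} :
    v ∈ boundary G S ↔ v ∉ S ∧ ∃ s ∈ S, G.Adj s v := by
  simp [boundary]

theorem card_callees_le {S : Finset V} {x : V} (hx : x ∈ S) :
    (callees G x).card ≤ S.card + (boundary G S).card := by
  refine (Finset.card_le_card (t := S ∪ boundary G S) fun v hv => ?_).trans
    (Finset.card_union_le _ _)
  rw [Finset.mem_union]
  by_cases hvS : v ∈ S
  · exact Or.inl hvS
  · right
    rw [mem_boundary]
    refine ⟨hvS, x, hx, ?_⟩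
    unfold callees at hv
    split_ifs at hv with h
    · simpa using hv
    · rw [Finset.mem_singleton] at hv
      exact absurd (hv ▸ hx) hvS

/-- The data shared by the growth phases: `r` rounds contain `r * k = q ^ 3` calls of each node,
and `J` levels suffice to exceed `n²`. -/
structure PhaseParams (n k r J : ℕ) (q : ℝ) : Prop where
  large : 10 ^ 6 ≤ q
  cube : q ^ 3 = (r * k : ℕ)
  levels_le : (J : ℝ) ≤ q
  lt_pow : (n : ℝ) ^ 2 < q ^ J

/-- The bound for the probability that a phase fails. -/
def phaseError (n J : ℕ) (q : ℝ) : ℝ := J * ((3 * n + 2) * Real.exp (-scale q))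

theorem phaseError_nonneg (n J : ℕ) (q : ℝ) : 0 ≤ phaseError n J q := by
  unfold phaseError; positivity

variable {G} {k r J m : ℕ} {q φ : ℝ}

/-- Small sets grow by a factor `1 + φ / 64` in each phase. -/
theorem reach_small (hP : PhaseParams (Fintype.card V) k r J q) (hφ : 1 < φ)
    (hexp : ∀ S : Finset V, 0 < S.card → S.card ≤ m → φ * S.card ≤ (boundary G S).card)
    {I : Finset V} (hI : I.Nonempty) (j : ℕ) :
    1 - j * phaseError (Fintype.card V) J q ≤ reach (callees G) k (j * (2 * J * r)) I
      fun Z => m ≤ Z.card ∨ (1 + φ / 64) ^ j ≤ (Z.card : ℝ) := by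
  have hN := callees_nonempty G
  have hs : ∀ u v, u ∈ callees G v → v ∈ callees G u := fun u v => callees_symm G
  induction j with
  | zero =>
    rw [reach_of hN]
    · simp
    · intro Z hZ
      right
      rw [pow_zero]
      exact_mod_cast (hI.mono hZ).card_pos
  | succ j ih =>
    have hc : ((j + 1 : ℕ) : ℝ) * phaseError (Fintype.card V) J q
        = j * phaseError (Fintype.card V) J q + phaseError (Fintype.card V) J q := by
      push_cast; ring
    rw [hc, Nat.succ_mul]
    refine reach_add_le hN (phaseError_nonneg _ _ _) ih fun Z hIZ hZ => ?_
    by_cases hm : m ≤ Z.card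
    · rw [reach_of hN fun Z' h => Or.inl (hm.trans (Finset.card_le_card h))]
      linarith [phaseError_nonneg (Fintype.card V) J q]
    have hZ1 : (1 + φ / 64) ^ j ≤ (Z.card : ℝ) := hZ.resolve_left hm
    have hZ0 : 0 < Z.card := (hI.mono hIZ).card_pos
    have hU := hexp Z hZ0 (not_le.1 hm).le
    have hZ0' : (0 : ℝ) < Z.card := Nat.cast_pos.2 hZ0
    have hUZ : (Z.card : ℝ) < (boundary G Z).card := by nlinarith
    have hUZ' : Z.card < (boundary G Z).card := by exact_mod_cast hUZ
    have hg := le_reach_gain hN hs hP.large (k := k) (a := r) hP.cube.le hP.levels_le hP.lt_pow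
      (S := Z) (U := boundary G Z) (Finset.card_pos.1 (by omega))
      (Finset.disjoint_left.2 fun v hv => ((mem_boundary G).1 hv).1)
      (fun v hv => by
        obtain ⟨_, x, hx, hadj⟩ := (mem_boundary G).1 hv
        exact ⟨x, hx, mem_callees_of_adj G hadj⟩)
      (Or.inl fun x hx => by have := card_callees_le G hx; omega)
    refine hg.trans (expect_mono fun l => ind_mono fun h => Or.inr ?_)
    calc (1 + φ / 64) ^ (j + 1) = (1 + φ / 64) ^ j * (1 + φ / 64) := pow_succ _ _
      _ ≤ Z.card * (1 + φ / 64) := by gcongr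
      _ = Z.card + φ * Z.card / 64 := by ring
      _ ≤ Z.card + (boundary G Z).card / 64 := by gcongr
      _ ≤ _ := h

/-- The time for `i + 1` phases beyond the size `m`, of which the last ones are the longest. -/
def middleTime (J r n : ℕ) (y : ℝ) : ℕ → ℕ
  | 0 => 2 * J * (r * ⌈2 * n / y⌉₊)
  | i + 1 => 2 * J * (r * ⌈2 * n / (y * (128 / 127) ^ i)⌉₊) + middleTime J r n y i

theorem middleTime_le (J r n : ℕ) {y : ℝ} (hy : 0 < y) (i : ℕ) :
    (middleTime J r n y i : ℝ) ≤ 2 * J * (r * (i + 1 + 258 * (n / y))) := by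
  have hny : 0 ≤ n / y := by positivity
  have hstep : ∀ i : ℕ, (⌈2 * n / (y * (128 / 127) ^ i)⌉₊ : ℝ)
      ≤ 2 * (n / y) * (127 / 128) ^ i + 1 := by
    intro i
    refine (Nat.ceil_lt_add_one (by positivity)).le.trans_eq ?_
    rw [show (127 / 128 : ℝ) = (128 / 127)⁻¹ by norm_num, inv_pow]
    field_simp
  -- partial sums of the geometric series with ratio `127 / 128`, plus the longest phase
  have h : (middleTime J r n y i : ℝ)
      ≤ 2 * J * (r * (i + 1 + 2 * (n / y) * (129 - 128 * (127 / 128) ^ i))) := by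
    induction i with
    | zero =>
      have := hstep 0
      simp only [pow_zero, mul_one] at this
      unfold middleTime
      push_cast
      gcongr
      linarith
    | succ i ih =>
      unfold middleTime
      push_cast
      calc _ ≤ 2 * J * (r * (2 * (n / y) * (127 / 128) ^ i + 1))
            + 2 * J * (r * (i + 1 + 2 * (n / y) * (129 - 128 * (127 / 128) ^ i))) := by
              gcongr
              exact hstep i
        _ = _ := by rw [pow_succ]; ring
  refine h.trans ?_
  have h1 : 0 ≤ (127 / 128 : ℝ) ^ i := by positivity
  have h2 : 2 * (n / y) * (129 - 128 * (127 / 128) ^ i) ≤ 258 * (n / y) := by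
    nlinarith [mul_nonneg hny h1]
  exact mul_le_mul_of_nonneg_left
    (mul_le_mul_of_nonneg_left (by linarith) (Nat.cast_nonneg r)) (by positivity)

/-- Growth from `m` nodes to more than half of the nodes. A set of `m` informed nodes and its
boundary cover `n / 2 + x` nodes, so with `h` informed nodes missing to `n / 2` there are at
least `h + x` nodes next to informed ones. A phase must last longer if this number is small, but
then it is reached by few phases only, as `h + x` decreases geometrically. -/
theorem reach_middle (hP : PhaseParams (Fintype.card V) k r J q) {x y : ℝ} (hx : 0 < x)
    (hm : 0 < m) (hxm : (1 + φ) * m = Fintype.card V / 2 + x) (hy : y = max x (1 / 2))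
    (hexp : ∀ S : Finset V, 0 < S.card → S.card ≤ m → φ * S.card ≤ (boundary G S).card)
    (i : ℕ) : ∀ Z : Finset V, m ≤ Z.card →
      (Fintype.card V : ℝ) / 2 - Z.card + y ≤ y * (128 / 127) ^ i →
      1 - (i + 1) * phaseError (Fintype.card V) J q
        ≤ reach (callees G) k (middleTime J r (Fintype.card V) y i) Z
          fun Z' => Fintype.card V < 2 * Z'.card := by
  have hN := callees_nonempty G
  have hs : ∀ u v, u ∈ callees G v → v ∈ callees G u := fun u v => callees_symm G
  have hE := phaseError_nonneg (Fintype.card V) J q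
  have hy0 : 0 < y := by rw [hy]; exact lt_max_of_lt_left hx
  have hQmono : ∀ Z Z' : Finset V, Z ⊆ Z' → Fintype.card V < 2 * Z.card →
      Fintype.card V < 2 * Z'.card := fun Z Z' h hZ => by
    have := Finset.card_le_card h; omega
  -- one phase, from a set that is not yet larger than half of the nodes
  have hphase : ∀ (Z : Finset V) (τ : ℕ), m ≤ Z.card → 2 * Z.card ≤ Fintype.card V →
      2 * (Fintype.card V : ℝ) / ((Fintype.card V : ℝ) / 2 - Z.card + y) ≤ τ →
      1 - phaseError (Fintype.card V) J q ≤ reach (callees G) k (2 * J * (r * τ)) Z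
        fun Z' => Z.card < Z'.card ∧ (Z.card : ℝ)
          + ((Fintype.card V : ℝ) / 2 - Z.card + y) / 128 ≤ Z'.card := by
    intro Z τ hmZ hZ2 hτ
    obtain ⟨S, hSZ, hScard⟩ := Finset.exists_subset_card_eq hmZ
    have hS := hexp S (by omega) hScard.le
    rw [hScard] at hS
    have hZ2' : 2 * (Z.card : ℝ) ≤ Fintype.card V := by exact_mod_cast hZ2
    set U := boundary G S \ Z with hUdef
    have hUge : (Fintype.card V : ℝ) / 2 - Z.card + x ≤ U.card := by
      have h1 : boundary G S ⊆ U ∪ (Z \ S) := by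
        intro v hv
        by_cases hvZ : v ∈ Z
        · exact Finset.mem_union_right _
            (Finset.mem_sdiff.2 ⟨hvZ, ((mem_boundary G).1 hv).1⟩)
        · exact Finset.mem_union_left _ (Finset.mem_sdiff.2 ⟨hv, hvZ⟩)
      have h2 := (Finset.card_le_card h1).trans (Finset.card_union_le _ _)
      have h3 : (Z \ S).card + m = Z.card := by
        rw [← hScard, Finset.card_sdiff_add_card_eq_card hSZ]
      have h4 : ((boundary G S).card : ℝ) + m ≤ U.card + Z.card := by
        exact_mod_cast (by omega : (boundary G S).card + m ≤ U.card + Z.card)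
      linarith
    have hU0 : 0 < U.card := by
      have : (0 : ℝ) < U.card := by linarith
      exact_mod_cast this
    have hU1 : (1 : ℝ) ≤ U.card := by exact_mod_cast hU0
    set h := (Fintype.card V : ℝ) / 2 - Z.card + y with hh
    have hh0 : 0 < h := by rw [hh]; linarith
    have hUh : h ≤ 2 * U.card := by
      rcases max_cases x (1 / 2) with ⟨h1, _⟩ | ⟨h1, _⟩
      · rw [h1] at hy; linarith
      · rw [h1] at hy; linarith
    have hτU : (Fintype.card V : ℝ) ≤ τ * U.card := by
      rw [div_le_iff₀ hh0] at hτ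
      have : (τ : ℝ) * h ≤ τ * (2 * U.card) := by gcongr
      linarith
    have hq1 : 1 ≤ q := by linarith [hP.large]
    have hτ1 : (1 : ℝ) ≤ τ := by
      have : 0 < τ := by
        rcases Nat.eq_zero_or_pos τ with h0 | h0
        · exfalso
          rw [h0, Nat.cast_zero, zero_mul] at hτU
          have : (U.card : ℝ) ≤ Fintype.card V := by exact_mod_cast Finset.card_le_univ _
          linarith
        · exact h0
      exact_mod_cast this
    have hcalls : ((r * τ * k : ℕ) : ℝ) = q ^ 3 * τ := by
      rw [hP.cube]; push_cast; ring
    have hq3 : 0 ≤ q ^ 3 := by positivity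
    have hg := le_reach_gain hN hs hP.large (k := k) (a := r * τ) (S := Z) (U := U)
      (by rw [hcalls]; exact le_mul_of_one_le_right hq3 hτ1) hP.levels_le hP.lt_pow
      (Finset.card_pos.1 hU0) Finset.sdiff_disjoint
      (fun v hv => by
        obtain ⟨_, x, hx, hadj⟩ := (mem_boundary G).1 (Finset.mem_sdiff.1 hv).1
        exact ⟨x, hSZ hx, mem_callees_of_adj G hadj⟩)
      (Or.inr (by
        rw [hcalls]
        calc q ^ 2 * (Fintype.card V : ℝ) ≤ q ^ 3 * Fintype.card V :=
              mul_le_mul_of_nonneg_right (pow_le_pow_right₀ hq1 (by norm_num))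
                (Nat.cast_nonneg _)
          _ ≤ q ^ 3 * (τ * U.card) := by gcongr
          _ = _ := by ring))
    refine hg.trans (expect_mono fun l => ind_mono fun hl => ⟨?_, by linarith⟩)
    have : (Z.card : ℝ) < (spread Z l).card := by linarith
    exact_mod_cast this
  induction i with
  | zero =>
    intro Z hmZ hZ
    by_cases hhalf : Fintype.card V < 2 * Z.card
    · rw [reach_of hN fun Z' h => hQmono _ _ h hhalf]
      push_cast
      linarith
    rw [not_lt] at hhalf
    have hhalf' : 2 * (Z.card : ℝ) ≤ Fintype.card V := by exact_mod_cast hhalf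
    have h1 := hphase Z ⌈2 * (Fintype.card V : ℝ) / y⌉₊ hmZ hhalf (by
      refine le_trans ?_ (Nat.le_ceil _)
      gcongr
      linarith)
    simp only [CharP.cast_eq_zero, zero_add, one_mul]
    refine h1.trans (expect_mono fun l => ind_mono fun hl => ?_)
    rw [pow_zero, mul_one] at hZ
    have h2 : (Fintype.card V : ℝ) ≤ 2 * Z.card := by linarith
    have h3 : Fintype.card V ≤ 2 * Z.card := by exact_mod_cast h2
    omega
  | succ i ih =>
    intro Z hmZ hZ
    by_cases hcase : (Fintype.card V : ℝ) / 2 - Z.card + y ≤ y * (128 / 127) ^ i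
    · refine le_trans ?_ ((ih Z hmZ hcase).trans (reach_mono_time hN (Nat.le_add_left _ _) hQmono))
      push_cast
      linarith
    rw [not_le] at hcase
    have hpow : 0 < y * (128 / 127 : ℝ) ^ i := by positivity
    have hpow1 : y ≤ y * (128 / 127 : ℝ) ^ i :=
      le_mul_of_one_le_right hy0.le (one_le_pow₀ (by norm_num))
    have hhalf' : 2 * (Z.card : ℝ) ≤ Fintype.card V := by linarith
    have hhalf : 2 * Z.card ≤ Fintype.card V := by exact_mod_cast hhalf'
    have h1 := hphase Z ⌈2 * (Fintype.card V : ℝ) / (y * (128 / 127) ^ i)⌉₊ hmZ hhalf (by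
      refine le_trans ?_ (Nat.le_ceil _)
      gcongr)
    have h2 := reach_add_le hN (Q' := fun Z' => Fintype.card V < 2 * Z'.card)
      (T' := middleTime J r (Fintype.card V) y i)
      (e' := (i + 1) * phaseError (Fintype.card V) J q) (by positivity) h1
      (fun Z' hZZ' hZ' => ih Z' (hmZ.trans (Finset.card_le_card hZZ')) (by
        rw [pow_succ] at hZ
        linarith [hZ'.2]))
    refine le_trans (le_of_eq ?_) h2
    push_cast
    ring

end Half

end

/-! ### From half of the nodes to all nodes, and the law of the process -/

section

variable {V : Type*} [Fintype V] [DecidableEq V]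

section Everybody

variable {N : V → Finset V}

theorem expect_const_mul {K : ℕ} (T : ℕ) (c : ℝ) (F : List (V → Fin K → V) → ℝ) :
    expect N K T (fun l => c * F l) = c * expect N K T F := by
  induction T generalizing F with
  | zero => rfl
  | succ T ih => simp only [expect, ih]; exact avg_const_mul _ _

theorem expect_ind_not (hN : ∀ v, (N v).Nonempty) {K : ℕ} (T : ℕ)
    (P : List (V → Fin K → V) → Prop) :
    expect N K T (fun l => ind (¬P l)) = 1 - expect N K T fun l => ind (P l) := by
  have h := expect_add (N := N) (K := K) T (fun l => ind (¬P l)) fun l => ind (P l)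
  simp only [ind_not, sub_add_cancel] at h
  rw [expect_const hN] at h
  simp only [ind_not]
  linarith

/-- If from every node the rumor reaches more than half of the nodes in `T` rounds, then it
reaches all nodes in `2 T` rounds: the set that a node `v` reaches in the second half of the
rounds, in reverse order, meets the set informed by the first half. -/
theorem le_reach_univ (hN : ∀ v, (N v).Nonempty) {k T : ℕ} {e : ℝ}
    (h : ∀ v, 1 - e ≤ reach N k T {v} fun Z => Fintype.card V < 2 * Z.card) (s : V) :
    1 - Fintype.card V * (2 * e) ≤ reach N k (T + T) {s} fun Z => Z = Finset.univ := by
  set Q : Finset V → Prop := fun Z => Fintype.card V < 2 * Z.card with hQdef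
  have hv : ∀ v, expect N k (T + T) (fun l => ind (v ∉ spread {s} l)) ≤ 2 * e := by
    intro v
    rw [expect_append]
    have h1 : ∀ l l' : List (V → Fin k → V), ind (v ∉ spread {s} (l ++ l'))
        ≤ ind (¬Q (spread {s} l)) + ind (¬Q (spread {v} l'.reverse)) := by
      intro l l'
      refine ind_le_add fun hv => ?_
      by_contra! hQ
      obtain ⟨h1, h2⟩ := hQ
      have hne : (spread {s} l ∩ spread {v} l'.reverse).Nonempty := by
        rw [← Finset.not_disjoint_iff_nonempty_inter]
        intro hd
        have h3 := Finset.card_union_of_disjoint hd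
        have h4 := Finset.card_le_univ (spread {s} l ∪ spread {v} l'.reverse)
        simp only [hQdef] at h1 h2
        omega
      obtain ⟨w, hw⟩ := spread_inter_nonempty l' hne
      rw [Finset.mem_inter, Finset.mem_singleton] at hw
      apply hv
      rw [spread_append]
      exact hw.2 ▸ hw.1
    refine (expect_mono fun l => expect_mono fun l' => h1 l l').trans ?_
    simp only [expect_add, expect_const hN]
    rw [expect_reverse T (fun l => ind (¬Q (spread {v} l))), expect_ind_not hN,
      expect_ind_not hN]
    have h2 := h s
    have h3 := h v
    unfold reach at h2 h3
    linarith
  have h1 : ∀ l : List (V → Fin k → V), 1 ≤ ind (spread {s} l = Finset.univ)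
      + ∑ v, ind (v ∉ spread {s} l) := by
    intro l
    have h2 := ind_exists_le_sum fun v => v ∉ spread {s} l
    have h3 := ind_le_add (P := True) (Q := spread {s} l = Finset.univ)
      (R := ∃ v, v ∉ spread {s} l) fun _ => by
        by_contra! h
        exact h.1 (Finset.eq_univ_of_forall h.2)
    rw [ind_of trivial] at h3
    linarith
  have h2 := expect_mono (N := N) (T := T + T) h1
  rw [expect_const hN, expect_add, expect_sum] at h2
  have h3 : ∑ v, expect N k (T + T) (fun l => ind (v ∉ spread {s} l))
      ≤ Fintype.card V * (2 * e) :=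
    (Finset.sum_le_sum fun v _ => hv v).trans_eq (by simp)
  unfold reach
  linarith

variable (G : SimpleGraph V) [DecidableRel G.Adj]

theorem roundCalls_map_toReal (k : ℕ) (I J : Finset V) :
    ((roundCalls G k).map (step I) J).toReal
      = avg (callees G) k fun x => ind (step I x = J) := by
  rw [PMF.map_apply, tsum_fintype, ENNReal.toReal_sum]
  · have h : ∀ x, (if J = step I x then roundCalls G k x else 0).toReal
        = if x ∈ outcomes (callees G) k then
            ind (step I x = J) / (outcomes (callees G) k).card else 0 := by
      intro x
      unfold roundCalls
      rw [PMF.uniformOfFinset_apply, show callOutcomes G k = outcomes (callees G) k from rfl]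
      by_cases hJ : step I x = J
      · rw [if_pos hJ.symm, ind_of hJ]
        split_ifs <;> simp
      · rw [if_neg (Ne.symm hJ), ind_of_not hJ]
        simp
    refine (Finset.sum_congr rfl fun x _ => by convert h x).trans ?_
    unfold avg
    rw [Finset.sum_ite_mem, Finset.univ_inter, Finset.sum_div]
  · intro x _
    split_ifs
    · exact PMF.apply_ne_top _ _
    · exact ENNReal.zero_ne_top

/-- The law of the informed set, in terms of averages over the calls. -/
theorem informedLaw_toReal (k : ℕ) (s : V) (T : ℕ) (J : Finset V) :
    (informedLaw G k s T J).toReal = reach (callees G) k T {s} fun Z => Z = J := by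
  classical
  induction T generalizing J with
  | zero =>
    unfold informedLaw reach
    simp only [expect, spread_nil, PMF.pure_apply]
    by_cases h : {s} = J
    · rw [if_pos h.symm, ind_of h, ENNReal.toReal_one]
    · rw [if_neg (Ne.symm h), ind_of_not h, ENNReal.toReal_zero]
  | succ T ih =>
    unfold informedLaw
    rw [PMF.bind_apply, tsum_fintype, ENNReal.toReal_sum
      (fun I _ => ENNReal.mul_ne_top (PMF.apply_ne_top _ _) (PMF.apply_ne_top _ _))]
    simp only [ENNReal.toReal_mul, ih, roundCalls_map_toReal]
    unfold reach
    rw [expect_succ_last]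
    simp only [spread_append, spread_cons, spread_nil]
    have h : ∀ l : List (V → Fin k → V),
        (avg (callees G) k fun x => ind (step (spread {s} l) x = J))
          = ∑ I, (avg (callees G) k fun x => ind (step I x = J)) * ind (spread {s} l = I) := by
      intro l
      rw [Finset.sum_eq_single (spread {s} l), ind_of rfl, mul_one]
      · intro I _ hI
        rw [ind_of_not hI.symm, mul_zero]
      · exact fun h => absurd (Finset.mem_univ _) h
    simp only [h, expect_sum, expect_const_mul]
    exact Finset.sum_congr rfl fun _ _ => mul_comm _ _

end Everybody

end

/-! ### Choice of the parameters -/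

section

theorem one_lt_log_of_three_le {n : ℕ} (hn : 3 ≤ n) : 1 < Real.log n := by
  have hn' : (3 : ℝ) ≤ n := by exact_mod_cast hn
  rw [Real.lt_log_iff_exp_lt (by linarith)]
  linarith [Real.exp_one_lt_d9]

/-- The choice of the parameters. As `k` exceeds `log³ n`, a bounded number `r` of rounds
supplies enough calls for errors of polynomial order, and `7 max {1, log_k n}` levels suffice
since the growth per level is about `k ^ (1 / 3)`. The factor `447 n` bounds the number of phases,
and `2 n` comes from the reversal of time. -/
theorem exists_phaseParams {c : ℝ} (hc : 0 < c) :
    ∃ r : ℕ, 0 < r ∧ ∀ n k : ℕ, 3 ≤ n → Real.log n ^ 3 < k →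
      ∃ (J : ℕ) (q : ℝ), PhaseParams n k r J q ∧ (J : ℝ) ≤ 7 * max 1 (Real.logb k n) ∧
        n * (2 * (447 * n * phaseError n J q)) ≤ (n : ℝ) ^ (-c) := by
  set b : ℕ := 10 ^ 6 * ⌈c + 20⌉₊ with hb
  have hceil : 1 ≤ ⌈c + 20⌉₊ := Nat.one_le_ceil_iff.2 (by linarith)
  have hb1 : (10 : ℝ) ^ 6 * (c + 20) ≤ b := by
    rw [hb]
    rw [Nat.cast_mul]
    push_cast
    exact mul_le_mul_of_nonneg_left (Nat.le_ceil (c + 20)) (by norm_num) |>.trans_eq (by norm_num)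
  have hb6 : (10 : ℝ) ^ 6 ≤ b := by nlinarith
  have hbpos : 0 < b := by omega
  -- `q = b * k ^ (1 / 3)` with `b` proportional to `c + 20`, so that `exp (-scale q)` is at
  -- most `n ^ (-(c + 20))`
  refine ⟨b ^ 3, by positivity, fun n k hn hk => ?_⟩
  have hn' : (3 : ℝ) ≤ n := by exact_mod_cast hn
  have hn0 : (0 : ℝ) < n := by linarith
  have hlog := one_lt_log_of_three_le hn
  set M : ℝ := max 1 (Real.logb k n) with hM
  have hM1 : 1 ≤ M := le_max_left _ _
  obtain ⟨t, ht0, ht3⟩ : ∃ t : ℝ, 0 ≤ t ∧ t ^ 3 = k :=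
    ⟨(k : ℝ) ^ ((1 : ℝ) / 3), by positivity, by
      rw [← Real.rpow_natCast, ← Real.rpow_mul (Nat.cast_nonneg k)]; norm_num⟩
  have htlog : Real.log n < t := lt_of_pow_lt_pow_left₀ 3 ht0 (by rwa [ht3])
  have hk2 : (2 : ℝ) ≤ k := by
    have h1 : (1 : ℝ) < k := lt_trans (one_lt_pow₀ hlog (by norm_num)) hk
    have h2 : 1 < k := by exact_mod_cast h1
    exact_mod_cast h2
  have hlogk : 1 / 2 ≤ Real.log k := by
    have := Real.log_le_log (by norm_num) hk2
    linarith [Real.log_two_gt_d9]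
  have hlogt : 3 * Real.log t = Real.log k := by
    rw [← ht3, Real.log_pow]; norm_num
  have hMlog : Real.log n ≤ M * Real.log k := by
    have h : Real.logb k n ≤ M := le_max_right _ _
    rwa [Real.logb, div_le_iff₀ (by linarith)] at h
  have hM2 : M ≤ 2 * Real.log n := by
    refine max_le (by linarith) ?_
    rw [Real.logb, div_le_iff₀ (by linarith)]
    nlinarith
  have hJ1 : (⌊7 * M⌋₊ : ℝ) ≤ 7 * M := Nat.floor_le (by linarith)
  have hJ2 : 6 * M ≤ (⌊7 * M⌋₊ : ℝ) := by
    have := Nat.lt_floor_add_one (7 * M)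
    linarith
  have hlog_le : Real.log n ≤ n := by linarith [Real.log_le_sub_one_of_pos hn0]
  set J := ⌊7 * M⌋₊
  set q : ℝ := b * t with hq
  have hqb : (b : ℝ) * Real.log n ≤ q := by rw [hq]; gcongr
  have hP : PhaseParams n k (b ^ 3) J q := by
    refine ⟨?_, ?_, ?_, ?_⟩
    · nlinarith
    · rw [hq, mul_pow, ht3]; push_cast; ring
    · nlinarith
    · have hq0 : 0 < q := lt_of_lt_of_le (by nlinarith) hqb
      have htq : t < q := by rw [hq]; nlinarith
      rw [← Real.log_lt_log_iff (by positivity) (by positivity), Real.log_pow, Real.log_pow]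
      have h1 : Real.log t < Real.log q := Real.log_lt_log (by linarith) htq
      have h2 : 6 * M * Real.log t ≤ J * Real.log t :=
        mul_le_mul_of_nonneg_right hJ2 (by linarith)
      have h3 : J * Real.log t < J * Real.log q :=
        mul_lt_mul_of_pos_left h1 (by linarith)
      push_cast
      nlinarith
  refine ⟨J, q, hP, hJ1, ?_⟩
  have hexp : Real.exp (-scale q) ≤ (n : ℝ) ^ (-c) * ((n : ℝ) ^ 20)⁻¹ := by
    rw [← Real.rpow_natCast, ← Real.rpow_neg hn0.le, ← Real.rpow_add hn0,
      Real.rpow_def_of_pos hn0, Real.exp_le_exp]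
    unfold scale
    have h1 : 10 ^ 6 * (c + 20) * Real.log n ≤ q := le_trans (by gcongr) hqb
    push_cast
    linarith
  have h1 : phaseError n J q ≤ 14 * n * (5 * n * ((n : ℝ) ^ (-c) * ((n : ℝ) ^ 20)⁻¹)) := by
    unfold phaseError
    have h2 : (J : ℝ) ≤ 14 * n := by linarith
    have h3 : 3 * (n : ℝ) + 2 ≤ 5 * n := by linarith
    gcongr
  have h3 : (62580 : ℝ) ≤ n ^ 16 :=
    le_trans (by norm_num) (pow_le_pow_left₀ (by norm_num) hn' 16)
  calc n * (2 * (447 * n * phaseError n J q))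
      ≤ n * (2 * (447 * n * (14 * n * (5 * n * ((n : ℝ) ^ (-c) * ((n : ℝ) ^ 20)⁻¹))))) := by
        gcongr
    _ = (n : ℝ) ^ (-c) * (62580 / (n : ℝ) ^ 16) := by
        field_simp
        ring
    _ ≤ (n : ℝ) ^ (-c) * 1 := by
        gcongr
        rw [div_le_one (by positivity)]
        exact h3
    _ = _ := mul_one _

variable {V : Type*} [Fintype V] [DecidableEq V] {G : SimpleGraph V} [DecidableRel G.Adj]

variable (G) in
theorem card_add_card_boundary_le (S : Finset V) :
    S.card + (boundary G S).card ≤ Fintype.card V := by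
  rw [← Finset.card_union_of_disjoint]
  · exact Finset.card_le_univ _
  · rw [Finset.disjoint_left]
    exact fun v hv hb => ((mem_boundary G).1 hb).1 hv

/-- `j` phases for small sets, followed by `i + 1` longer ones, inform more than half of the
nodes. -/
theorem reach_half {k r J m : ℕ} {q φ : ℝ} (hP : PhaseParams (Fintype.card V) k r J q)
    (hφ : 1 < φ) {x y : ℝ} (hx : 0 < x) (hm : 0 < m)
    (hxm : (1 + φ) * m = Fintype.card V / 2 + x) (hy : y = max x (1 / 2))
    (hyn : y ≤ (Fintype.card V : ℝ) / 2)
    (hexp : ∀ S : Finset V, 0 < S.card → S.card ≤ m → φ * S.card ≤ (boundary G S).card)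
    {i j : ℕ} (hj : (m : ℝ) ≤ (1 + φ / 64) ^ j)
    (hi : (Fintype.card V : ℝ) / y ≤ (128 / 127) ^ i) (v : V) :
    1 - (j + (i + 1)) * phaseError (Fintype.card V) J q
      ≤ reach (callees G) k (j * (2 * J * r) + middleTime J r (Fintype.card V) y i) {v}
        fun Z => Fintype.card V < 2 * Z.card := by
  have hE := phaseError_nonneg (Fintype.card V) J q
  have hy0 : 0 < y := by rw [hy]; exact lt_max_of_lt_left hx
  have h := reach_add_le (callees_nonempty G) (T' := middleTime J r (Fintype.card V) y i)
    (Q' := fun Z => Fintype.card V < 2 * Z.card)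
    (e' := (i + 1) * phaseError (Fintype.card V) J q) (by positivity)
    (reach_small hP hφ hexp (Finset.singleton_nonempty v) j)
    (fun Z _ hZ => by
      have hmZ : m ≤ Z.card := by
        rcases hZ with hZ | hZ
        · exact hZ
        · exact_mod_cast hj.trans hZ
      refine reach_middle hP hx hm hxm hy hexp i Z hmZ ?_
      rw [div_le_iff₀ hy0] at hi
      have : (0 : ℝ) ≤ Z.card := Nat.cast_nonneg _
      linarith)
  refine le_trans (le_of_eq ?_) h
  ring

end

/-! ### Number of phases -/

section

/-- The number of phases of growth by a factor `1 + φ / 64` that lead to `n` nodes. -/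
theorem exists_smallPhases {φ : ℝ} (hφ : 1 < φ) {n : ℕ} (hn : φ < n) :
    ∃ j : ℕ, (j : ℝ) ≤ 128 * Real.logb φ n ∧ j ≤ 64 * n ∧ (n : ℝ) ≤ (1 + φ / 64) ^ j := by
  have hlogφ := Real.log_pos hφ
  have hlogn : Real.log φ < Real.log n := Real.log_lt_log (by linarith) hn
  have hL : 1 ≤ Real.logb φ n := by
    rw [Real.logb, one_le_div hlogφ]; exact hlogn.le
  have hn0 : (0 : ℝ) < n := by linarith
  set l := Real.logb (1 + φ) n with hl
  have hlL : l ≤ Real.logb φ n := by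
    rw [hl, Real.logb, Real.logb]
    have := Real.log_le_log (by linarith) (by linarith : φ ≤ 1 + φ)
    gcongr
  have hl0 : 0 ≤ l := Real.logb_nonneg (by linarith) (by linarith)
  refine ⟨64 * ⌈l⌉₊, ?_, ?_, ?_⟩
  · have := Nat.ceil_lt_add_one hl0
    push_cast
    linarith
  · refine Nat.mul_le_mul_left 64 (Nat.ceil_le.2 ?_)
    rw [hl, Real.logb_le_iff_le_rpow (by linarith) hn0, Real.rpow_natCast]
    calc (n : ℝ) ≤ 2 ^ n := by exact_mod_cast Nat.lt_two_pow_self.le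
      _ ≤ (1 + φ) ^ n := by gcongr; linarith
  · calc (n : ℝ) = (1 + φ) ^ l := (Real.rpow_logb (by linarith) (by linarith) hn0).symm
      _ ≤ (1 + φ) ^ (⌈l⌉₊ : ℝ) := Real.rpow_le_rpow_of_exponent_le (by linarith) (Nat.le_ceil l)
      _ = (1 + φ) ^ ⌈l⌉₊ := Real.rpow_natCast _ _
      _ ≤ ((1 + φ / 64) ^ 64) ^ ⌈l⌉₊ := by
          have := one_add_mul_le_pow (a := φ / 64) (by linarith) 64
          gcongr
          push_cast at this
          linarith
      _ = _ := (pow_mul _ _ _).symm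

/-- The number of phases in which the number of missing nodes decreases by a factor
`127 / 128`. -/
theorem exists_middlePhases {w : ℝ} (hw : 1 ≤ w) {n : ℕ} (hn : w ≤ 2 * n) :
    ∃ i : ℕ, (i : ℝ) ≤ 254 * w ∧ i ≤ 254 * n ∧ w ≤ (128 / 127) ^ i := by
  refine ⟨127 * ⌈w⌉₊, ?_, ?_, ?_⟩
  · have := Nat.ceil_lt_add_one (by linarith : 0 ≤ w)
    push_cast
    linarith
  · have : ⌈w⌉₊ ≤ 2 * n := Nat.ceil_le.2 (by exact_mod_cast hn)
    omega
  · have h := one_add_mul_le_pow (a := (1 / 127 : ℝ)) (by norm_num) (127 * ⌈w⌉₊)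
    have := Nat.le_ceil w
    push_cast at h
    norm_num at h ⊢
    linarith

end

end RumorSpreading

end

theorem theorem1 (c : ℝ) (hc : 0 < c) :
    ∃ C : ℝ, 0 < C ∧
      ∀ (V : Type*) [Fintype V] [DecidableEq V] (G : SimpleGraph V) [DecidableRel G.Adj]
        (φ α : ℝ) (k : ℕ) (s : V),
        1 < φ →
        1 / (2 + 2 * φ) < α →
        (∃ m : ℕ, α * (Fintype.card V : ℝ) = m) →
        RumorSpreading.IsVertexExpander G φ α →
        Real.log (Fintype.card V) ^ 3 < (k : ℝ) →
        1 - (Fintype.card V : ℝ) ^ (-c) ≤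
          RumorSpreading.probAllInformed G k s
            ⌊C * ((Real.logb φ (Fintype.card V) + φ⁻¹ * (α - 1 / (2 + 2 * φ))⁻¹) *
              max 1 (Real.logb k (Fintype.card V)))⌋₊ := by
  obtain ⟨r, hr, hparams⟩ := RumorSpreading.exists_phaseParams hc
  have hr' : (0 : ℝ) < r := by exact_mod_cast hr
  refine ⟨15000 * r, by positivity, ?_⟩
  intro V _ _ G _ φ α k s hφ hα hm hG hk
  obtain ⟨m, hm⟩ := hm
  obtain ⟨⟨_, hφn⟩, ⟨hα0, hα2⟩, hex⟩ := hG
  set n := Fintype.card V with hndef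
  have hn1 : (0 : ℝ) < n := by linarith
  have hm0 : 0 < m := by
    have : (0 : ℝ) < m := by rw [← hm]; positivity
    exact_mod_cast this
  have hexp : ∀ S : Finset V, 0 < S.card → S.card ≤ m →
      φ * S.card ≤ (RumorSpreading.boundary G S).card := by
    intro S hS hSm
    have h := hex S hS (by rw [hm]; exact_mod_cast hSm)
    rwa [le_div_iff₀ (by exact_mod_cast hS)] at h
  -- a node has more than `φ > 1` neighbors
  have hn3 : 3 ≤ n := by
    have h1 := hexp {s} (by simp) (by rw [Finset.card_singleton]; omega)
    have h2 := RumorSpreading.card_add_card_boundary_le G {s}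
    rw [Finset.card_singleton] at h1 h2
    have h3 : (1 : ℝ) < (RumorSpreading.boundary G {s}).card := by
      push_cast at h1; linarith
    have h4 : 1 < (RumorSpreading.boundary G {s}).card := by exact_mod_cast h3
    omega
  have hn3' : (3 : ℝ) ≤ n := by exact_mod_cast hn3
  obtain ⟨J, q, hP, hJ, herr⟩ := hparams n k hn3 hk
  set δ := α - 1 / (2 + 2 * φ) with hδ
  have hδ0 : 0 < δ := by linarith
  set x : ℝ := n * ((1 + φ) * δ) with hxdef
  have hx : 0 < x := by positivity
  have hxm : (1 + φ) * m = n / 2 + x := by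
    rw [hxdef, hδ, ← hm]
    field_simp
    ring
  -- a set of `m` nodes and its boundary fit into the graph
  have hxn : x ≤ n / 2 := by
    have hmn : m ≤ n := by
      have : (m : ℝ) ≤ n := by rw [← hm]; nlinarith
      exact_mod_cast this
    obtain ⟨S, _, hS⟩ := Finset.exists_subset_card_eq
      (s := (Finset.univ : Finset V)) (n := m) (by rwa [Finset.card_univ])
    have h1 := hexp S (by omega) hS.le
    have h2 := RumorSpreading.card_add_card_boundary_le G S
    rw [hS] at h1 h2
    have h3 : (m : ℝ) + (RumorSpreading.boundary G S).card ≤ n := by exact_mod_cast h2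
    linarith
  set y : ℝ := max x (1 / 2) with hy
  have hy0 : 0 < y := lt_max_of_lt_left hx
  have hyn : y ≤ n / 2 := max_le hxn (by linarith)
  have hw1 : 1 ≤ n / y := by rw [one_le_div hy0]; linarith
  have hw2 : n / y ≤ 2 * n := by
    rw [div_le_iff₀ hy0]
    have : 1 / 2 ≤ y := le_max_right _ _
    nlinarith
  have hwP : n / y ≤ φ⁻¹ * δ⁻¹ := by
    rw [← mul_inv, div_le_iff₀ hy0, inv_mul_eq_div, le_div_iff₀ (by positivity)]
    refine le_trans ?_ (le_max_left x _)
    rw [hxdef]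
    gcongr
    linarith
  obtain ⟨j, hjL, hjn, hj⟩ := RumorSpreading.exists_smallPhases hφ hφn
  obtain ⟨i, hiw, hin, hi⟩ := RumorSpreading.exists_middlePhases hw1 hw2
  have hmn : (m : ℝ) ≤ n := by rw [← hm]; nlinarith
  have hhalf := RumorSpreading.reach_half hP hφ hx hm0 hxm hy hyn hexp (hmn.trans hj) hi
  have huniv := RumorSpreading.le_reach_univ (RumorSpreading.callees_nonempty G) hhalf s
  have hT := RumorSpreading.middleTime_le J r n hy0 i
  set T := j * (2 * J * r) + RumorSpreading.middleTime J r n y i with hTdef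
  set M := max 1 (Real.logb k n) with hM
  have hM1 : 1 ≤ M := le_max_left _ _
  have hL0 : 0 ≤ Real.logb φ n := Real.logb_nonneg hφ (by linarith)
  have htime : T + T ≤ ⌊15000 * r * ((Real.logb φ n + φ⁻¹ * δ⁻¹) * M)⌋₊ := by
    refine Nat.le_floor ?_
    have h1 : (T : ℝ) ≤ J * (2 * r * (128 * Real.logb φ n + 513 * (φ⁻¹ * δ⁻¹))) := by
      calc (T : ℝ) ≤ j * (2 * J * r) + 2 * J * (r * (i + 1 + 258 * (n / y))) := by
            rw [hTdef]; push_cast; linarith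
        _ = J * (2 * r * (j + (i + 1 + 258 * (n / y)))) := by ring
        _ ≤ _ := by
            gcongr
            linarith
    have h2 : J * (2 * r * (128 * Real.logb φ n + 513 * (φ⁻¹ * δ⁻¹)))
        ≤ 7 * M * (2 * r * (128 * Real.logb φ n + 513 * (φ⁻¹ * δ⁻¹))) := by
      have : 0 ≤ φ⁻¹ * δ⁻¹ := by positivity
      gcongr
    have h3 : 0 ≤ r * M * Real.logb φ n := by positivity
    have h4 : 0 ≤ r * M * (φ⁻¹ * δ⁻¹) := by positivity
    push_cast
    linarith
  have hfail : n * (2 * ((j + (i + 1)) * RumorSpreading.phaseError n J q)) ≤ (n : ℝ) ^ (-c) := by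
    refine le_trans ?_ herr
    have h1 : (j : ℝ) ≤ 64 * n := by exact_mod_cast hjn
    have h2 : (i : ℝ) ≤ 254 * n := by exact_mod_cast hin
    have := RumorSpreading.phaseError_nonneg n J q
    gcongr
    linarith
  unfold RumorSpreading.probAllInformed
  rw [RumorSpreading.informedLaw_toReal]
  have hmono := RumorSpreading.reach_mono_time (RumorSpreading.callees_nonempty G) (k := k)
    htime (I := {s}) (Q := fun Z => Z = Finset.univ)
    (fun Z Z' h hZ => Finset.univ_subset_iff.1 (hZ ▸ h))
  linarith
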